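/- Let $H^2_8$ be the equilateral triangle lattice of the hyperbolic plane in which $8$ triangles meet at every vertex, i.e. a triangulated plane (a connected, simply connected, noncompact triangulated surface without boundary) in which every vertex belongs to exactly $8$ triangles, with a black/white colouring of its triangles such that any two distinct triangles with a common edge have opposite colours. For a vertex $o$ and an integer $k\ge 0$ let $D_k$ be the standard ball, i.e. the set of vertices at edge distance at most $k$ from $o$, and let $\partial D_k$ be the set of vertices at distance exactly $k$. A real- or complex-valued function $\psi$ on the vertices of $D_k$ is called d-holomorphic in $D_k$ if $(Q^b\psi)(T)=\sum_{P\in T}\psi(P)=0$ for every black triangle $T$ all of whose vertices lie in $D_k$. Let $r\ge 0$. Then $D_{r+1}$ is finite, $|\partial D_{r+1}|$ is even, and the number $N_{r+1}$ of vertices of $D_{r+1}$ and the number $Eq_{r+1}$ of equations $Q^b\psi=0$ in $D_{r+1}$ (black triangles with all vertices in $D_{r+1}$) satisfy $$N_{r+1}-Eq_{r+1}=\frac{|\partial D_{r+1}|}{2}+1 .$$ This number is the dimension of the space of d-holomorphic functions in $D_{r+1}$ and the number of necessary boundary data: there is a set $S\subseteq\partial D_{r+1}$ of exactly $|\partial D_{r+1}|/2+1$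 boundary vertices such that every d-holomorphic function in $D_{r+1}$ is uniquely determined by its values on $S$, and these values can be prescribed arbitrarily; and no set of fewer boundary vertices has the property that the values on it determine every d-holomorphic function in $D_{r+1}$. -/

import Mathlib

namespace AbstractSimplicialComplex

variable {V : Type*} [DecidableEq V]

/-- The graph of vertices and edges of a simplicial complex. -/
def edgeGraph (K : AbstractSimplicialComplex V) : SimpleGraph V where
  Adj x y := x ≠ y ∧ {x, y} ∈ K.faces
  symm := ⟨fun x y h => ⟨h.1.symm, by rw [Finset.pair_comm]; exact h.2⟩⟩
  loopless := ⟨fun _ h => h.1 rfl⟩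

/-- The triangles (two-dimensional simplices). -/
def triangles (K : AbstractSimplicialComplex V) : Set (Finset V) :=
  {T | T ∈ K.faces ∧ T.card = 3}

/-- The link of a vertex `v` (of a complex of dimension at most two), as a graph: its vertices are
the neighbours of `v`, its edges are the edges opposite to `v` in the triangles containing `v`. -/
def linkGraph (K : AbstractSimplicialComplex V) (v : V) :
    SimpleGraph {x : V // K.edgeGraph.Adj v x} where
  Adj x y := x ≠ y ∧ {v, x.1, y.1} ∈ K.faces
  symm := ⟨fun x y h => ⟨h.1.symm, by rw [Finset.pair_comm]; exact h.2⟩⟩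
  loopless := ⟨fun _ h => h.1 rfl⟩

/-- Combinatorial homotopy (with fixed endpoints) of edge paths: the congruence generated by
removing a backtracking and by replacing two sides of a triangle by the third side. -/
inductive EdgeHomotopic (K : AbstractSimplicialComplex V) :
    {x y : V} → K.edgeGraph.Walk x y → K.edgeGraph.Walk x y → Prop
  | refl {x y : V} (p : K.edgeGraph.Walk x y) : EdgeHomotopic K p p
  | symm {x y : V} {p q : K.edgeGraph.Walk x y} :
      EdgeHomotopic K p q → EdgeHomotopic K q p
  | trans {x y : V} {p q s : K.edgeGraph.Walk x y} :
      EdgeHomotopic K p q → EdgeHomotopic K q s → EdgeHomotopic K p s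
  | cons {x y z : V} (h : K.edgeGraph.Adj x y) {p q : K.edgeGraph.Walk y z} :
      EdgeHomotopic K p q → EdgeHomotopic K (.cons h p) (.cons h q)
  | backtrack {x y z : V} (h : K.edgeGraph.Adj x y) (p : K.edgeGraph.Walk x z) :
      EdgeHomotopic K (.cons h (.cons h.symm p)) p
  | triangle {x y z w : V} (hxy : K.edgeGraph.Adj x y) (hyz : K.edgeGraph.Adj y z)
      (hxz : K.edgeGraph.Adj x z) (hT : {x, y, z} ∈ K.faces) (p : K.edgeGraph.Walk z w) :
      EdgeHomotopic K (.cons hxy (.cons hyz p)) (.cons hxz p)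

/-- `K` is a triangulated plane: a connected, simply connected, infinite (hence noncompact)
triangulated surface without boundary, i.e. a two-dimensional complex in which the link of every
vertex is a (finite) cycle. -/
structure IsTriangulatedPlane (K : AbstractSimplicialComplex V) : Prop where
  card_le_three : ∀ T ∈ K.faces, T.card ≤ 3
  link_cycle : ∀ v, ∃ m : ℕ, 3 ≤ m ∧ Nonempty (SimpleGraph.cycleGraph m ≃g K.linkGraph v)
  infinite : Infinite V
  connected : K.edgeGraph.Connected
  simplyConnected : ∀ (x : V) (p : K.edgeGraph.Walk x x), K.EdgeHomotopic p .nil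

/-- The equilateral triangle lattice `H²_m` (for `m ≥ 7`): a triangulated plane in which exactly
`m` triangles meet at every vertex. -/
structure IsEquilateralLattice (K : AbstractSimplicialComplex V) (m : ℕ) : Prop
    extends IsTriangulatedPlane K where
  degree : ∀ v, {T | T ∈ K.triangles ∧ v ∈ T}.ncard = m

/-- A black/white colouring of the triangles: two distinct triangles with a common edge have
opposite colours. The white triangles are those that are not black. -/
structure BWColoring (K : AbstractSimplicialComplex V) where
  black : Set (Finset V)
  black_subset : black ⊆ K.triangles
  opposite : ∀ S ∈ K.triangles, ∀ T ∈ K.triangles, (S ∩ T).card = 2 → (S ∈ black ↔ T ∉ black)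

/-- The standard ball `D_r` about the vertex `o`. -/
def ball (K : AbstractSimplicialComplex V) (o : V) (r : ℕ) : Set V :=
  {x | K.edgeGraph.dist o x ≤ r}

/-- The boundary `∂D_r` of the standard ball: the vertices at distance exactly `r` from `o`. -/
def ballBoundary (K : AbstractSimplicialComplex V) (o : V) (r : ℕ) : Set V :=
  {x | K.edgeGraph.dist o x = r}

namespace BWColoring

variable {K : AbstractSimplicialComplex V}

/-- The black triangles all of whose vertices lie in the domain `D`. -/
def blackIn (c : BWColoring K) (D : Set V) : Set (Finset V) :=
  {T | T ∈ c.black ∧ (T : Set V) ⊆ D}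

/-- The black triangle operator `(Q^b ψ)(T) = ∑_{P ∈ T} ψ(P)` on functions on the vertices of `D`,
with values in functions on the black triangles in `D`. -/
def blackOperator (c : BWColoring K) (𝕜 : Type*) [Field 𝕜] (D : Set V) :
    (D → 𝕜) →ₗ[𝕜] (c.blackIn D → 𝕜) where
  toFun ψ T := ∑ P : {P // P ∈ T.1}, ψ ⟨P.1, T.2.2 P.2⟩
  map_add' ψ φ := by
    funext T
    simp [Finset.sum_add_distrib]
  map_smul' a ψ := by
    funext T
    simp [Finset.mul_sum]

/-- The space of d-holomorphic functions in the domain `D`: the solutions of `Q^b ψ = 0`. -/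
def dHolomorphic (c : BWColoring K) (𝕜 : Type*) [Field 𝕜] (D : Set V) : Submodule 𝕜 (D → 𝕜) :=
  LinearMap.ker (c.blackOperator 𝕜 D)

/-- The values of a d-holomorphic function in `D` at the vertices of `S ⊆ D`. -/
def boundaryValues (c : BWColoring K) (𝕜 : Type*) [Field 𝕜] {D S : Set V} (hS : S ⊆ D)
    (ψ : c.dHolomorphic 𝕜 D) : S → 𝕜 :=
  fun x => ψ.1 ⟨x.1, hS x.2⟩

end BWColoring

/-- The boundary of a ball is contained in the ball. -/
theorem ballBoundary_subset_ball (K : AbstractSimplicialComplex V) (o : V) (r : ℕ) :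
    K.ballBoundary o r ⊆ K.ball o r :=
  fun _ hx => le_of_eq hx

end AbstractSimplicialComplex

/-! ### A word model of the triangle lattice of degree eight

Vertices are words: the empty word is the root, and `j :: v` is the `j`-th child of `v`. The
children of consecutive vertices of a layer follow one another in the next layer, the last child of
a vertex being the first child of its successor. -/

/-! Around a vertex at distance `n + 1` from `o` the layered structure is rigid: there are two
neighbours in its own layer, one or two parents in the layer below, and the remaining neighbours lie
in the layer above. Triangle colours alternate around each vertex, and everything follows from these
two facts.

Layer structure. A combinatorial model is built whose vertices are words, with an explicit cyclic
list of neighbours `flip`. A vertex of `K` together with a word and a cyclic labelling of its link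
is a point of a covering of `K`; `flip_flip` and `flip_triangle` say that continuation along edges
is reversible and consistent around triangles. Since `K` is simply connected, `exists_section`
yields a global labelling `w` (`exists_isDeveloping`). Only `o` carries the empty word
(`eq_of_word_eq_nil`), so distance from `o` is word length (`dist_eq`).

Counting. Among the black triangles of `D_{n+1}` meeting the boundary, a boundary vertex with one
parent (`arity` 4) lies in exactly one, which has two boundary vertices. A vertex with two parents
(`arity` 3) lies either in one with no other boundary vertex or in two with two boundary vertices
each. Hence twice the number of these triangles is the size of the layer plus the number of its
two-parent vertices. From the second layer on, the latter number is the size of the preceding layer,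
and induction gives `2 N = 2 Eq + |∂D| + 2` (`even_and_two_mul_ncard_ball`).

Dimension and boundary data. Every black triangle meeting the boundary has a boundary vertex in no
other black triangle of the ball (`exists_pivot`), so the equations can be solved layer by layer
with any right-hand side: the operator is surjective and its kernel has dimension `N - Eq`. Every
vertex has a black triangle whose other two vertices are one layer further out (`exists_black_up`),
so zero boundary values propagate inwards (`eq_zero_of_boundary`). Evaluations at boundary vertices
therefore separate the kernel, and a basis of its dual can be chosen among them; fewer evaluations
cannot be injective. -/

namespace LatticeWord

/-- The number of children of a vertex, the first child of its successor not being counted. -/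
def arity : List ℕ → ℕ
  | [] => 8
  | [_] => 4
  -- Below the root, degree 8 is `arity` own children, one shared child, two neighbours in the
  -- layer, and the parents. A first child in layer two or beyond has two parents, hence one child
  -- fewer.
  | 0 :: _ :: _ => 3
  | (_ + 1) :: _ :: _ => 4

/-- A word is valid if each letter is smaller than the arity of the word following it. -/
def Valid : List ℕ → Prop
  | [] => True
  | j :: v => j < arity v ∧ Valid v

/-- The successor in the cyclic order of a layer. -/
def next : List ℕ → List ℕ
  | [] => []
  -- The value `next [] = []` closes layer one into a cycle: `[7]` is followed by `[0]`.
  | j :: v => if j + 1 < arity v then (j + 1) :: v else 0 :: next v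

/-- The predecessor in the cyclic order of a layer. -/
def prev : List ℕ → List ℕ
  | [] => []
  | 0 :: v => (arity (prev v) - 1) :: prev v
  | (j + 1) :: v => j :: v

theorem three_le_arity (v : List ℕ) : 3 ≤ arity v := by
  rcases v with _ | ⟨_ | j, _ | ⟨a, v⟩⟩ <;> simp [arity]

theorem arity_cons_le (j : ℕ) (v : List ℕ) : arity (j :: v) ≤ 4 := by
  rcases v with _ | ⟨a, v⟩ <;> rcases j with _ | j <;> simp [arity]

theorem arity_eq_of_ne_nil {v : List ℕ} (hv : v ≠ []) : arity v = 3 ∨ arity v = 4 := by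
  rcases v with _ | ⟨_ | j, _ | ⟨a, v⟩⟩ <;> simp_all [arity]

theorem arity_succ_cons (j : ℕ) (v : List ℕ) : arity ((j + 1) :: v) = 4 := by
  rcases v with _ | ⟨a, v⟩ <;> simp [arity]

theorem arity_cons_of_pos {j : ℕ} (hj : 0 < j) (v : List ℕ) : arity (j :: v) = 4 := by
  obtain ⟨j, rfl⟩ := Nat.exists_eq_succ_of_ne_zero hj.ne'
  exact arity_succ_cons j v

theorem arity_zero_cons {v : List ℕ} (hv : v ≠ []) : arity (0 :: v) = 3 := by
  rcases v with _ | ⟨a, v⟩ <;> simp_all [arity]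

@[simp] theorem length_next (v : List ℕ) : (next v).length = v.length := by
  induction v with
  | nil => rfl
  | cons j v ih => rw [next]; split_ifs <;> simp [ih]

@[simp] theorem length_prev (v : List ℕ) : (prev v).length = v.length := by
  induction v with
  | nil => rfl
  | cons j v ih => rcases j with _ | j <;> simp [prev, ih]

theorem next_ne_nil {v : List ℕ} (hv : v ≠ []) : next v ≠ [] := by
  rw [← List.length_pos_iff] at *; simpa

theorem prev_ne_nil {v : List ℕ} (hv : v ≠ []) : prev v ≠ [] := by
  rw [← List.length_pos_iff] at *; simpa

theorem Valid.next {v : List ℕ} (hv : Valid v) : Valid (next v) := by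
  induction v with
  | nil => trivial
  | cons j v ih =>
    rw [LatticeWord.next]
    split_ifs with h
    · exact ⟨h, hv.2⟩
    · exact ⟨by have := three_le_arity (LatticeWord.next v); omega, ih hv.2⟩

theorem Valid.prev {v : List ℕ} (hv : Valid v) : Valid (prev v) := by
  induction v with
  | nil => trivial
  | cons j v ih =>
    rcases j with _ | j
    · exact ⟨by have := three_le_arity (LatticeWord.prev v); omega, ih hv.2⟩
    · exact ⟨by have := hv.1; omega, hv.2⟩

theorem prev_next {v : List ℕ} (hv : Valid v) : prev (next v) = v := by
  induction v with
  | nil => rfl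
  | cons j v ih =>
    rw [next]
    split_ifs with h
    · rfl
    · have := hv.1
      rw [prev, ih hv.2]
      congr 1
      omega

theorem next_prev {v : List ℕ} (hv : Valid v) : next (prev v) = v := by
  induction v with
  | nil => rfl
  | cons j v ih =>
    rcases j with _ | j
    · have := three_le_arity (prev v)
      rw [prev, next, if_neg (by omega), ih hv.2]
    · rw [prev, next, if_pos hv.1]

/-! ### Gluing rules of the word model. -/

/-- The neighbours of a vertex in cyclic order, each with the index of the vertex among the
neighbours of that neighbour. -/
def flip (m : List ℕ) (i : Fin 8) : List ℕ × Fin 8 :=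
  match m with
  | [] => ([i.val], 6)
  | t :: v =>
    if i.val = 0 then (0 :: t :: v, 5)
    else if i.val < arity (t :: v) then (i.val :: t :: v, 6)
    else if i.val = arity (t :: v) then (0 :: next (t :: v), 6)
    else if i.val = arity (t :: v) + 1 then (next (t :: v), 7)
    else if i.val = arity (t :: v) + 2 then (v, Fin.ofNat 8 t)
    else if i.val = 7 then (prev (t :: v), Fin.ofNat 8 (arity (prev (t :: v)) + 1))
    -- What remains is index 6 when the arity is 3: the other parent `prev v`, for which this vertex
    -- is the shared last child.
    else (prev v, Fin.ofNat 8 (arity (prev v)))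

variable {m v : List ℕ}

theorem flip_nil (i : Fin 8) : flip [] i = ([i.val], 6) := rfl

theorem flip_zero (hm : m ≠ []) : flip m 0 = (0 :: m, 5) := by
  rcases m with _ | ⟨t, v⟩ <;> simp_all [flip]

theorem flip_child {i : Fin 8} (h0 : 0 < i.val) (hi : i.val < arity m) :
    flip m i = (i.val :: m, 6) := by
  rcases m with _ | ⟨t, v⟩
  · rfl
  · simp [flip, h0.ne', hi]

theorem flip_arity {i : Fin 8} (hm : m ≠ []) (hi : i.val = arity m) :
    flip m i = (0 :: next m, 6) := by
  have := three_le_arity m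
  rcases m with _ | ⟨t, v⟩
  · simp_all
  · simp only [flip]
    rw [if_neg (by omega), if_neg (by omega), if_pos hi]

theorem flip_next {i : Fin 8} (hm : m ≠ []) (hi : i.val = arity m + 1) :
    flip m i = (next m, 7) := by
  rcases m with _ | ⟨t, v⟩
  · simp_all
  · simp only [flip]
    rw [if_neg (by omega), if_neg (by omega), if_neg (by omega), if_pos hi]

theorem flip_parent {i : Fin 8} {t : ℕ} (hi : i.val = arity (t :: v) + 2) :
    flip (t :: v) i = (v, Fin.ofNat 8 t) := by
  simp only [flip]
  rw [if_neg (by omega), if_neg (by omega), if_neg (by omega), if_neg (by omega), if_pos hi]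

theorem flip_seven (hm : m ≠ []) :
    flip m 7 = (prev m, Fin.ofNat 8 (arity (prev m) + 1)) := by
  rcases m with _ | ⟨t, v⟩
  · simp_all
  · have := arity_cons_le t v
    simp only [flip]
    rw [if_neg (by simp), if_neg (by simp; omega), if_neg (by simp; omega),
      if_neg (by simp; omega), if_neg (by simp; omega), if_pos (by simp)]

theorem flip_zero_cons_six (hv : v ≠ []) :
    flip (0 :: v) 6 = (prev v, Fin.ofNat 8 (arity (prev v))) := by
  have := arity_zero_cons hv
  simp [flip, this]

theorem ofNat_eq {i : Fin 8} {n : ℕ} (h : i.val = n) : Fin.ofNat 8 n = i := by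
  subst h; ext; simp

/-- Every index is one of the seven kinds of position around a vertex other than the root. -/
theorem index_cases {t : ℕ} (i : Fin 8) :
    i = 0 ∨ (0 < i.val ∧ i.val < arity (t :: v)) ∨ i.val = arity (t :: v) ∨
      i.val = arity (t :: v) + 1 ∨ i.val = arity (t :: v) + 2 ∨ i = 7 ∨
      (i = 6 ∧ t = 0 ∧ v ≠ []) := by
  have h : i = 0 ∨ 0 < i.val := by
    rw [Fin.ext_iff, Fin.val_zero]; omega
  have h6 : i.val = 6 → i = 6 := fun h => Fin.ext h
  have h7 : i.val = 7 → i = 7 := fun h => Fin.ext h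
  have := i.2
  rcases v with _ | ⟨a, v⟩ <;> rcases t with _ | t <;> simp only [arity] <;> grind

theorem valid_flip (hm : Valid m) (i : Fin 8) : Valid (flip m i).1 := by
  rcases m with _ | ⟨t, v⟩
  · exact ⟨i.2, trivial⟩
  have h3 := three_le_arity (t :: v)
  rcases index_cases (t := t) (v := v) i with rfl | ⟨h0, h⟩ | h | h | h | rfl | ⟨rfl, rfl, hv⟩
  · rw [flip_zero (by simp)]; exact ⟨by omega, hm⟩
  · rw [flip_child h0 h]; exact ⟨h, hm⟩
  · rw [flip_arity (by simp) h]
    exact ⟨by have := three_le_arity (next (t :: v)); omega, hm.next⟩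
  · rw [flip_next (by simp) h]; exact hm.next
  · rw [flip_parent h]; exact hm.2
  · rw [flip_seven (by simp)]; exact hm.prev
  · rw [flip_zero_cons_six hv]; exact hm.2.prev

theorem flip_flip (hm : Valid m) (i : Fin 8) : flip (flip m i).1 (flip m i).2 = (m, i) := by
  rcases m with _ | ⟨t, v⟩
  · rw [flip_nil, flip_parent (by simp [arity])]
    simp
  have h3 := three_le_arity (t :: v)
  have h4 := arity_cons_le t v
  rcases index_cases (t := t) (v := v) i with rfl | ⟨h0, h⟩ | h | h | h | rfl | ⟨rfl, rfl, hv⟩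
  · rw [flip_zero (by simp)]
    dsimp only
    rw [flip_parent (by simp [arity])]; rfl
  · rw [flip_child h0 h]
    dsimp only
    rw [flip_parent (by rw [arity_cons_of_pos h0]; rfl), ofNat_eq rfl]
  · rw [flip_arity (by simp) h]
    dsimp only
    rw [flip_zero_cons_six (next_ne_nil (by simp)), prev_next hm, ofNat_eq h]
  · rw [flip_next (by simp) h]
    dsimp only
    rw [flip_seven (next_ne_nil (by simp)), prev_next hm, ofNat_eq h]
  · rw [flip_parent h]
    dsimp only
    have ht := hm.1
    rcases Nat.eq_zero_or_pos t with rfl | h0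
    · by_cases hv : v = []
      · subst hv
        rw [flip_nil]
        simp [arity] at h ⊢
        ext; simp [h]
      · rw [show Fin.ofNat 8 0 = 0 from rfl, flip_zero hv]
        rw [arity_zero_cons hv] at h
        simp only [Prod.mk.injEq, true_and]
        ext; simp [h]
    · have h8 : t < 8 := by
        by_cases hv : v = []
        · subst hv; simpa [arity] using ht
        · have := arity_eq_of_ne_nil hv; omega
      have hval : (Fin.ofNat 8 t).val = t := by simp [Nat.mod_eq_of_lt h8]
      rw [flip_child (by omega) (by omega), hval]
      rw [arity_cons_of_pos h0] at h
      simp only [Prod.mk.injEq, true_and]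
      ext; simp [h]
  · rw [flip_seven (by simp)]
    dsimp only
    have hp := prev_ne_nil (v := t :: v) (by simp)
    have := arity_eq_of_ne_nil hp
    rw [flip_next hp (by simp; omega), next_prev hm]
  · rw [flip_zero_cons_six hv]
    dsimp only
    have hp := prev_ne_nil hv
    have := arity_eq_of_ne_nil hp
    rw [flip_arity hp (by simp; omega), next_prev hm.2]

/-- The three sides of a triangle of the word model fit together. -/
theorem flip_triangle (hm : Valid m) (i : Fin 8) :
    flip (flip m (i + 1)).1 ((flip m (i + 1)).2 + 1) = ((flip m i).1, (flip m i).2 - 1) := by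
  rcases m with _ | ⟨t, v⟩
  · rw [flip_nil, flip_nil]
    dsimp only
    rw [show (6 : Fin 8) + 1 = 7 from rfl, flip_seven (by simp)]
    revert i
    decide
  have h3 := three_le_arity (t :: v)
  have h4 := arity_cons_le t v
  have hval : ∀ i : Fin 8, i.val < 7 → (i + 1).val = i.val + 1 := by decide
  rcases index_cases (t := t) (v := v) i with rfl | ⟨h0, h⟩ | h | h | h | rfl | ⟨rfl, rfl, hv⟩
  · rw [flip_zero (by simp), zero_add, flip_child (m := t :: v) (i := 1) (by simp) (by simp; omega)]
    dsimp only
    rw [show (6 : Fin 8) + 1 = 7 from rfl, flip_seven (by simp)]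
    simp [prev, arity]
  · have hi := hval i (by omega)
    rw [flip_child h0 h]
    rcases Nat.lt_or_ge (i.val + 1) (arity (t :: v)) with h' | h'
    · rw [flip_child (m := t :: v) (i := i + 1) (by omega) (by omega), hi]
      dsimp only
      rw [show (6 : Fin 8) + 1 = 7 from rfl, flip_seven (by simp), prev, arity_cons_of_pos h0]
      rfl
    · rw [flip_arity (m := t :: v) (i := i + 1) (by simp) (by omega)]
      dsimp only
      rw [show (6 : Fin 8) + 1 = 7 from rfl, flip_seven (by simp), prev, prev_next hm,
        show arity (t :: v) - 1 = i.val by omega, arity_cons_of_pos h0]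
      rfl
  · have hi := hval i (by omega)
    rw [flip_arity (by simp) h, flip_next (m := t :: v) (i := i + 1) (by simp) (by omega)]
    dsimp only
    rw [show (7 : Fin 8) + 1 = 0 from rfl, flip_zero (next_ne_nil (by simp))]
    rfl
  · have hi := hval i (by omega)
    rw [flip_next (by simp) h, flip_parent (by omega)]
    dsimp only
    have ht := hm.1
    rw [next]
    by_cases hv : v = []
    · subst hv
      rw [flip_nil]
      clear hi h h3 h4 hm hval
      simp only [arity] at ht
      interval_cases t <;> simp [arity, next]; decide
    · have := arity_eq_of_ne_nil hv
      have hval' : (Fin.ofNat 8 t + 1).val = t + 1 := by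
        rw [hval _ (by simp; omega)]; simp; omega
      split_ifs with h'
      · rw [flip_child (by omega) (by omega), hval']; rfl
      · rw [flip_arity hv (by omega)]; rfl
  · rw [flip_parent h]
    rcases Nat.eq_zero_or_pos t with rfl | h0
    · by_cases hv : v = []
      · subst hv
        simp only [arity] at h
        obtain rfl : i = 6 := Fin.ext h
        decide
      · rw [arity_zero_cons hv] at h
        obtain rfl : i = 5 := Fin.ext h
        rw [show (5 : Fin 8) + 1 = 6 from rfl, flip_zero_cons_six hv]
        dsimp only
        have hp := prev_ne_nil hv
        have := arity_eq_of_ne_nil hp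
        rw [flip_next hp (by rw [hval _ (by simp; omega)]; simp; omega), next_prev hm.2]
        rfl
    · rw [arity_cons_of_pos h0] at h
      obtain rfl : i = 6 := Fin.ext h
      rw [show (6 : Fin 8) + 1 = 7 from rfl, flip_seven (by simp)]
      dsimp only
      obtain ⟨t, rfl⟩ := Nat.exists_eq_succ_of_ne_zero h0.ne'
      have := arity_cons_le t v
      have := three_le_arity (t :: v)
      rw [prev, flip_parent (by rw [hval _ (by simp; omega)]; simp; omega)]
      simp only [Prod.mk.injEq, true_and]
      rw [eq_sub_iff_add_eq]
      ext
      simp [Fin.val_add]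
  · rw [show (7 : Fin 8) + 1 = 0 from rfl, flip_zero (by simp), flip_seven (by simp)]
    dsimp only
    rw [show (5 : Fin 8) + 1 = 6 from rfl, flip_zero_cons_six (by simp)]
    simp only [Prod.mk.injEq, true_and]
    rw [eq_sub_iff_add_eq]
    ext
    simp [Fin.val_add]
  · rw [show (6 : Fin 8) + 1 = 7 from rfl, flip_seven (by simp), flip_zero_cons_six hv]
    dsimp only
    have hp := prev_ne_nil hv
    have h3' := arity_eq_of_ne_nil hp
    have h4' : arity (prev (0 :: v)) = 4 := arity_cons_of_pos (by omega) _
    rw [h4', show Fin.ofNat 8 (4 + 1) + 1 = 6 from rfl, prev,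
      flip_parent (by rw [prev] at h4'; rw [h4']; rfl)]
    rcases h3' with h | h <;> rw [h] <;> rfl

end LatticeWord

namespace AbstractSimplicialComplex

variable {V : Type*} [DecidableEq V] {K : AbstractSimplicialComplex V}

/-! ### Charts: cyclic parametrizations of the links -/

theorem adj_of_mem_faces {T : Finset V} (hT : T ∈ K.faces) {x y : V} (hx : x ∈ T) (hy : y ∈ T)
    (hxy : x ≠ y) : K.edgeGraph.Adj x y :=
  ⟨hxy, K.isRelLowerSet_faces.mem_of_le hT
    (Finset.insert_subset hx (Finset.singleton_subset_iff.2 hy)) (Finset.insert_nonempty _ _)⟩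

/-- A cyclic parametrization of the link of a vertex. -/
structure IsChart (K : AbstractSimplicialComplex V) (x : V) {m : ℕ} [NeZero m] (φ : Fin m → V) :
    Prop where
  three_le : 3 ≤ m
  adj : ∀ i, K.edgeGraph.Adj x (φ i)
  injective : Function.Injective φ
  surj : ∀ y, K.edgeGraph.Adj x y → ∃ i, φ i = y
  face_iff : ∀ i j, i ≠ j → ({x, φ i, φ j} ∈ K.faces ↔ j = i + 1 ∨ i = j + 1)

namespace IsChart

variable {x y z : V} {m : ℕ} [NeZero m] {φ ψ : Fin m → V}

theorem add_one_ne (hφ : IsChart K x φ) (i : Fin m) : i + 1 ≠ i := by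
  intro h
  have := hφ.three_le
  rw [add_eq_left, Fin.ext_iff] at h
  simp [Nat.mod_eq_of_lt (show 1 < m by omega)] at h

theorem add_one_add_one_ne (hφ : IsChart K x φ) (i : Fin m) : i + 1 + 1 ≠ i := by
  rw [add_assoc]
  intro h
  have := hφ.three_le
  rw [add_eq_left, Fin.ext_iff] at h
  simp [Fin.val_add, Nat.mod_eq_of_lt (show 2 < m by omega)] at h

theorem sub_one_ne (hφ : IsChart K x φ) (i : Fin m) : i - 1 ≠ i := by
  rw [Ne, sub_eq_iff_eq_add]
  exact (hφ.add_one_ne i).symm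

theorem face (hφ : IsChart K x φ) (i : Fin m) : {x, φ i, φ (i + 1)} ∈ K.faces :=
  (hφ.face_iff _ _ (hφ.add_one_ne i).symm).2 (.inl rfl)

theorem card_triangle (hφ : IsChart K x φ) (i : Fin m) :
    ({x, φ i, φ (i + 1)} : Finset V).card = 3 :=
  Finset.card_eq_three.2 ⟨_, _, _, (hφ.adj i).1, (hφ.adj _).1,
    hφ.injective.ne (hφ.add_one_ne i).symm, rfl⟩

theorem triangle_mem (hφ : IsChart K x φ) (i : Fin m) :
    {x, φ i, φ (i + 1)} ∈ K.triangles :=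
  ⟨hφ.face i, hφ.card_triangle i⟩

theorem exists_eq_triangle (hφ : IsChart K x φ) {T : Finset V} (hT : T ∈ K.triangles)
    (hx : x ∈ T) : ∃ i, T = {x, φ i, φ (i + 1)} := by
  have h2 : (T.erase x).card = 2 := by rw [Finset.card_erase_of_mem hx, hT.2]
  obtain ⟨a, b, hab, h⟩ := Finset.card_eq_two.1 h2
  have hT' : T = {x, a, b} := by rw [← h, Finset.insert_erase hx]
  have ha : a ∈ T.erase x := by simp [h]
  have hb : b ∈ T.erase x := by simp [h]
  rw [Finset.mem_erase] at ha hb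
  obtain ⟨i, rfl⟩ := hφ.surj a (adj_of_mem_faces hT.1 hx ha.2 ha.1.symm)
  obtain ⟨j, rfl⟩ := hφ.surj b (adj_of_mem_faces hT.1 hx hb.2 hb.1.symm)
  have hf := hT.1
  rw [hT', hφ.face_iff _ _ (fun h => hab (congrArg φ h))] at hf
  rcases hf with rfl | rfl
  · exact ⟨i, hT'⟩
  · exact ⟨j, by rw [hT', Finset.pair_comm]⟩

theorem triangle_injective (hφ : IsChart K x φ) :
    Function.Injective fun i => ({x, φ i, φ (i + 1)} : Finset V) := by
  intro i j h
  have hmem : ∀ k, (φ k = φ i ∨ φ k = φ (i + 1)) ↔ (φ k = φ j ∨ φ k = φ (j + 1)) := by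
    intro k
    have := Finset.ext_iff.1 h (φ k)
    simpa [(hφ.adj k).1.symm] using this
  simp only [hφ.injective.eq_iff] at hmem
  rcases (hmem i).1 (.inl rfl) with h1 | h1
  · exact h1
  · rcases (hmem (i + 1)).1 (.inr rfl) with h2 | h2
    · exact absurd (h1 ▸ h2) (hφ.add_one_add_one_ne j)
    · exact add_right_cancel h2

theorem setOf_triangles (hφ : IsChart K x φ) :
    {T | T ∈ K.triangles ∧ x ∈ T} = Set.range fun i => ({x, φ i, φ (i + 1)} : Finset V) := by
  ext T
  constructor
  · rintro ⟨hT, hx⟩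
    obtain ⟨i, rfl⟩ := hφ.exists_eq_triangle hT hx
    exact ⟨i, rfl⟩
  · rintro ⟨i, rfl⟩
    exact ⟨hφ.triangle_mem i, by simp⟩

theorem ncard_triangles (hφ : IsChart K x φ) :
    {T | T ∈ K.triangles ∧ x ∈ T}.ncard = m := by
  rw [hφ.setOf_triangles, ← Set.image_univ, Set.ncard_image_of_injective _ hφ.triangle_injective,
    Set.ncard_univ, Nat.card_fin]

theorem comp_add (hφ : IsChart K x φ) (a : Fin m) : IsChart K x fun i => φ (i + a) where
  three_le := hφ.three_le
  adj i := hφ.adj _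
  injective i j h := by simpa using hφ.injective h
  surj y hy := by
    obtain ⟨i, rfl⟩ := hφ.surj y hy
    exact ⟨i - a, by simp⟩
  face_iff i j hij := by
    rw [hφ.face_iff _ _ (by simpa using hij), add_right_comm, add_right_comm j]
    simp

theorem comp_sub (hφ : IsChart K x φ) (a : Fin m) : IsChart K x fun i => φ (a - i) where
  three_le := hφ.three_le
  adj i := hφ.adj _
  injective i j h := by simpa using hφ.injective h
  surj y hy := by
    obtain ⟨i, rfl⟩ := hφ.surj y hy
    exact ⟨a - i, by simp⟩
  face_iff i j hij := by
    rw [hφ.face_iff _ _ (by simpa using hij), or_comm]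
    refine or_congr ?_ ?_
    · rw [sub_add, sub_right_inj, eq_sub_iff_add_eq, eq_comm]
    · rw [sub_add, sub_right_inj, eq_sub_iff_add_eq, eq_comm]

/-- This is the surface condition in usable form: an edge lies in exactly two triangles, one on each
side. -/
theorem eq_or_eq_of_face (hφ : IsChart K x φ) (i : Fin m) (hz : z ≠ φ i) (hxz : x ≠ z)
    (hf : {x, φ i, z} ∈ K.faces) : z = φ (i + 1) ∨ z = φ (i - 1) := by
  obtain ⟨j, rfl⟩ := hφ.surj z (adj_of_mem_faces hf (by simp) (by simp) hxz)
  rw [hφ.face_iff _ _ (fun h => hz (congrArg φ h.symm))] at hf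
  rcases hf with rfl | rfl <;> simp

theorem face_sub (hφ : IsChart K x φ) (i : Fin m) : {x, φ i, φ (i - 1)} ∈ K.faces := by
  rw [hφ.face_iff _ _ (hφ.sub_one_ne i).symm]; simp

theorem apply_add_one_ne (hφ : IsChart K x φ) (i : Fin m) : φ (i + 1) ≠ φ (i - 1) := by
  intro h
  have := hφ.injective h
  exact hφ.add_one_add_one_ne (i - 1) (by rw [sub_add_cancel, this])

/-- Two charts at adjacent vertices that agree on one of the common neighbours agree on the other
one. -/
theorem apply_add_one_eq (hφ : IsChart K x φ) (hψ : IsChart K y ψ) {i j : Fin m}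
    (hi : φ i = y) (hj : ψ j = x) (h : ψ (j - 1) = φ (i + 1)) : ψ (j + 1) = φ (i - 1) := by
  have hf := hφ.face_sub i
  have h1 : {y, ψ j, φ (i - 1)} ∈ K.faces := by rwa [hj, ← hi, Finset.insert_comm]
  rcases hψ.eq_or_eq_of_face j (hj ▸ (hφ.adj _).1.symm)
    (hi ▸ hφ.injective.ne (hφ.sub_one_ne i).symm) h1
    with h2 | h2
  · exact h2.symm
  · exact absurd (h.symm.trans h2.symm) (hφ.apply_add_one_ne i)

theorem apply_sub_one_eq (hφ : IsChart K x φ) (hψ : IsChart K y ψ) {i j : Fin m}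
    (hi : φ i = y) (hj : ψ j = x) (h : ψ (j + 1) = φ (i - 1)) : ψ (j - 1) = φ (i + 1) := by
  have hf := hφ.face i
  have h1 : {y, ψ j, φ (i + 1)} ∈ K.faces := by rwa [hj, ← hi, Finset.insert_comm]
  rcases hψ.eq_or_eq_of_face j (hj ▸ (hφ.adj _).1.symm)
    (hi ▸ hφ.injective.ne (hφ.add_one_ne _).symm) h1
    with h2 | h2
  · exact absurd (h2.trans h) (hφ.apply_add_one_ne i)
  · exact h2.symm

/-- A chart is determined by two consecutive values. -/
theorem eq_of_apply_eq (hφ : IsChart K x φ) (hψ : IsChart K x ψ) (j : Fin m)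
    (h0 : φ j = ψ j) (h1 : φ (j - 1) = ψ (j - 1)) : φ = ψ := by
  -- Agreement is carried around the cycle as a pair of consecutive values: the next value is the
  -- third vertex of the triangle on the other side of the edge.
  have key : ∀ k : ℕ, φ (j - 1 + Fin.ofNat m k) = ψ (j - 1 + Fin.ofNat m k) ∧
      φ (j + Fin.ofNat m k) = ψ (j + Fin.ofNat m k) := by
    intro k
    induction k with
    | zero => exact ⟨by simpa using h1, by simpa using h0⟩
    | succ k ih =>
      have e : Fin.ofNat m (k + 1) = Fin.ofNat m k + 1 := by
        ext; simp [Fin.val_add]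
      rw [e]
      set a := j + Fin.ofNat m k with ha
      have e1 : j - 1 + Fin.ofNat m k = a - 1 := by rw [ha]; abel
      have e2 : j - 1 + (Fin.ofNat m k + 1) = a := by rw [ha]; abel
      rw [e1] at ih
      rw [e2, ← add_assoc]
      refine ⟨ih.2, ?_⟩
      have hf := hφ.face a
      rw [ih.2] at hf
      rcases hψ.eq_or_eq_of_face a (ih.2 ▸ hφ.injective.ne (hφ.add_one_ne _)) (hφ.adj _).1 hf with h | h
      · exact h
      · exact absurd (h.trans ih.1.symm) (hφ.apply_add_one_ne a)
  funext i
  have := (key (i - j).val).2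
  simpa using this

/-- A chart can be continued to any neighbour, with any prescribed index. -/
theorem exists_continuation (hφ : IsChart K x φ) (hψ : IsChart K y ψ) {i : Fin m}
    (hi : φ i = y) (j : Fin m) :
    ∃ χ : Fin m → V, IsChart K y χ ∧ χ j = x ∧ χ (j - 1) = φ (i + 1) := by
  obtain ⟨a, ha⟩ := hψ.surj x (hi ▸ (hφ.adj i).symm)
  have hf : {y, ψ a, φ (i + 1)} ∈ K.faces := by
    rw [ha, ← hi, Finset.insert_comm]; exact hφ.face i
  rcases hψ.eq_or_eq_of_face a (ha ▸ (hφ.adj _).1.symm) (hi ▸ hφ.injective.ne (hφ.add_one_ne _).symm) hf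
    with h | h
  -- The given chart is reflected if its orientation disagrees with that of `φ`, and only rotated
  -- otherwise.
  · refine ⟨_, hψ.comp_sub (a + j), by simp [ha], ?_⟩
    rw [h]
    congr 1
    abel
  · refine ⟨_, hψ.comp_add (a - j), by simp [ha], ?_⟩
    rw [h]
    congr 1
    abel

end IsChart

theorem IsTriangulatedPlane.exists_chart (hK : K.IsTriangulatedPlane) (x : V) :
    ∃ (m : ℕ) (_ : NeZero m) (φ : Fin m → V), IsChart K x φ := by
  obtain ⟨m, hm, ⟨e⟩⟩ := hK.link_cycle x
  obtain ⟨n, rfl⟩ := Nat.exists_eq_add_of_le' hm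
  refine ⟨n + 3, inferInstance, fun i => (e i).1, hm, fun i => (e i).2, ?_, ?_, ?_⟩
  · exact Subtype.val_injective.comp e.injective
  · intro y hy
    exact ⟨e.symm ⟨y, hy⟩, by simp⟩
  · intro i j hij
    have h : (K.linkGraph x).Adj (e i) (e j) ↔ (SimpleGraph.cycleGraph (n + 3)).Adj i j :=
      e.map_adj_iff
    rw [SimpleGraph.cycleGraph_adj] at h
    have h' : (K.linkGraph x).Adj (e i) (e j) ↔ {x, (e i).1, (e j).1} ∈ K.faces :=
      ⟨fun h => h.2, fun h => ⟨e.injective.ne hij, h⟩⟩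
    rw [← h', h, sub_eq_iff_eq_add', sub_eq_iff_eq_add', or_comm]

/-- The length of the link cycle equals the number of triangles at the vertex. -/
theorem IsEquilateralLattice.exists_chart {m : ℕ} [NeZero m] (hK : K.IsEquilateralLattice m)
    (x : V) : ∃ φ : Fin m → V, IsChart K x φ := by
  obtain ⟨n, _, φ, hφ⟩ := hK.toIsTriangulatedPlane.exists_chart x
  have h := hφ.ncard_triangles
  rw [hK.degree x] at h
  subst h
  exact ⟨φ, hφ⟩

end AbstractSimplicialComplex

namespace AbstractSimplicialComplex

variable {V : Type*} [DecidableEq V] {K : AbstractSimplicialComplex V}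

/-! ### Coverings of simply connected complexes -/

section Covering

variable {E : Type*} {π : E → V} {R : E → E → Prop}

/-- The walk `p` lifts to a chain of `R`-steps from `e` to `e'`. -/
def Lifts (π : E → V) (R : E → E → Prop) :
    {x y : V} → K.edgeGraph.Walk x y → E → E → Prop
  | x, _, .nil, e, e' => π e = x ∧ e = e'
  | x, _, .cons _ p, e, e' => π e = x ∧ ∃ e₁, R e e₁ ∧ Lifts π R p e₁ e'

theorem Lifts.proj_eq {x y : V} {p : K.edgeGraph.Walk x y} {e e' : E} (h : Lifts π R p e e') :
    π e = x := by
  cases p with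
  | nil => exact h.1
  | cons _ _ => exact h.1

/-- Each generating move preserves the endpoints of lifts: a backtracking lifts to a backtracking by
symmetry and uniqueness of steps, and `htri` lets two sides of a triangle be exchanged for the
third. -/
theorem lifts_iff_of_edgeHomotopic (hsymm : ∀ e e', R e e' → R e' e)
    (hex : ∀ e y, K.edgeGraph.Adj (π e) y → ∃ e', π e' = y ∧ R e e')
    (huniq : ∀ e e₁ e₂, R e e₁ → R e e₂ → π e₁ = π e₂ → e₁ = e₂)
    (htri : ∀ e e₁ e₂, R e e₁ → R e₁ e₂ → π e ≠ π e₂ → {π e, π e₁, π e₂} ∈ K.faces → R e e₂)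
    {x y : V} {p q : K.edgeGraph.Walk x y} (h : K.EdgeHomotopic p q) :
    ∀ e e', Lifts π R p e e' ↔ Lifts π R q e e' := by
  induction h with
  | refl p => exact fun _ _ => Iff.rfl
  | symm _ ih => exact fun e e' => (ih e e').symm
  | trans _ _ ih₁ ih₂ => exact fun e e' => (ih₁ e e').trans (ih₂ e e')
  | cons h _ ih =>
    intro e e'
    simp only [Lifts, ih]
  | backtrack h p =>
    intro e e'
    constructor
    · rintro ⟨he, e₁, h₁, -, e₂, h₂, hp⟩
      rwa [← huniq e₁ e₂ e h₂ (hsymm _ _ h₁) (hp.proj_eq.trans he.symm)]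
    · intro hp
      have he := hp.proj_eq
      obtain ⟨e₁, he₁, h₁⟩ := hex e _ (he ▸ h)
      exact ⟨he, e₁, h₁, he₁, e, hsymm _ _ h₁, hp⟩
  | triangle hxy hyz hxz hT p =>
    intro e e'
    constructor
    · rintro ⟨he, e₁, h₁, he₁, e₂, h₂, hp⟩
      have he₂ := hp.proj_eq
      subst he he₁ he₂
      exact ⟨rfl, e₂, htri e e₁ e₂ h₁ h₂ hxz.1 hT, hp⟩
    · rintro ⟨he, e₂, h₂, hp⟩
      have he₂ := hp.proj_eq
      subst he he₂
      obtain ⟨e₁, rfl, h₁⟩ := hex e _ hxy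
      obtain ⟨e₃, he₃, h₃⟩ := hex e₁ _ hyz
      have h₄ := htri e e₁ e₃ h₁ h₃ (he₃ ▸ hxz.1) (he₃ ▸ hT)
      obtain rfl := huniq e e₃ e₂ h₄ h₂ he₃
      exact ⟨rfl, e₁, h₁, rfl, e₃, h₃, hp⟩

/-- A covering of a connected and simply connected complex has a section through every point. -/
theorem IsTriangulatedPlane.exists_section (hK : K.IsTriangulatedPlane)
    (hsymm : ∀ e e', R e e' → R e' e)
    (hadj : ∀ e e', R e e' → K.edgeGraph.Adj (π e) (π e'))
    (hex : ∀ e y, K.edgeGraph.Adj (π e) y → ∃ e', π e' = y ∧ R e e')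
    (huniq : ∀ e e₁ e₂, R e e₁ → R e e₂ → π e₁ = π e₂ → e₁ = e₂)
    (htri : ∀ e e₁ e₂, R e e₁ → R e₁ e₂ → π e ≠ π e₂ → {π e, π e₁, π e₂} ∈ K.faces → R e e₂)
    (e₀ : E) :
    ∃ s : V → E, (∀ x, π (s x) = x) ∧ s (π e₀) = e₀ ∧
      ∀ x y, K.edgeGraph.Adj x y → R (s x) (s y) := by
  have hwalk : ∀ e e', Relation.ReflTransGen R e e' →
      ∃ p : K.edgeGraph.Walk (π e) (π e'), Lifts π R p e e' := by
    intro e e' h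
    induction h using Relation.ReflTransGen.head_induction_on with
    | refl => exact ⟨.nil, rfl, rfl⟩
    | head h _ ih =>
      obtain ⟨p, hp⟩ := ih
      exact ⟨.cons (hadj _ _ h) p, rfl, _, h, hp⟩
  -- Trivial monodromy: a closed walk contracts to the constant walk, whose lift ends where it
  -- starts. So the part of `E` reachable from `e₀` meets each fibre at most once.
  have hclosed : ∀ e e', Relation.ReflTransGen R e e' → π e = π e' → e = e' := by
    intro e e' h hee
    obtain ⟨p, hp⟩ := hwalk e e' h
    revert p
    rw [← hee]
    intro p hp
    exact ((lifts_iff_of_edgeHomotopic hsymm hex huniq htri (hK.simplyConnected _ p) e e').1 hp).2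
  have hsym : Std.Symm (Relation.ReflTransGen R) := by
    have : Std.Symm R := ⟨hsymm⟩
    infer_instance
  have hreach : ∀ x, ∃ e, π e = x ∧ Relation.ReflTransGen R e₀ e := by
    intro x
    obtain ⟨p⟩ := hK.connected (π e₀) x
    generalize hy : π e₀ = y at p
    have : ∀ e, π e = y → ∃ e', π e' = x ∧ Relation.ReflTransGen R e e' := by
      clear hy
      induction p with
      | nil => exact fun e he => ⟨e, he, .refl⟩
      | cons h p ih =>
        intro e he
        obtain ⟨e₁, he₁, h₁⟩ := hex e _ (he ▸ h)
        obtain ⟨e', he', h'⟩ := ih e₁ he₁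
        exact ⟨e', he', .head h₁ h'⟩
    exact this e₀ hy
  choose s hs hs₀ using hreach
  have huniq' : ∀ e, Relation.ReflTransGen R e₀ e → s (π e) = e := fun e he =>
    hclosed _ _ ((hsym.symm _ _ (hs₀ _)).trans he) (hs _)
  refine ⟨s, hs, huniq' _ .refl, fun x y hxy => ?_⟩
  obtain ⟨e, rfl, he⟩ := hex (s x) y (by rwa [hs])
  rwa [huniq' e ((hs₀ x).tail he)]

end Covering

/-! ### The developing map to the word model -/

open LatticeWord

/-- A vertex of the complex with a chart and a vertex of the word model. -/
structure Development (K : AbstractSimplicialComplex V) where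
  base : V
  word : List ℕ
  chart : Fin 8 → V
  valid : Valid word
  isChart : IsChart K base chart

namespace Development

/-- Two developments at adjacent vertices are compatible. -/
def Step (e e' : Development K) : Prop :=
  -- The shift `- 1` against `+ 1` expresses coherent orientation: a triangle on one side of an edge
  -- is on the opposite side when seen from the other end.
  ∃ i, e.chart i = e'.base ∧ e'.word = (LatticeWord.flip e.word i).1 ∧
    e'.chart (LatticeWord.flip e.word i).2 = e.base ∧
    e'.chart ((LatticeWord.flip e.word i).2 - 1) = e.chart (i + 1)

theorem Step.symm {e e' : Development K} (h : Step e e') : Step e' e := by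
  obtain ⟨i, h1, h2, h3, h4⟩ := h
  have hf := flip_flip e.valid i
  rw [← h2] at hf
  refine ⟨_, h3, by rw [hf], by rw [hf]; exact h1, ?_⟩
  rw [hf]
  exact (e.isChart.apply_add_one_eq e'.isChart h1 h3 h4).symm

theorem Step.adj {e e' : Development K} (h : Step e e') : K.edgeGraph.Adj e.base e'.base := by
  obtain ⟨i, h1, -⟩ := h
  rw [← h1]
  exact e.isChart.adj i

theorem exists_step (hK : K.IsEquilateralLattice 8) (e : Development K) {y : V}
    (hy : K.edgeGraph.Adj e.base y) : ∃ e' : Development K, e'.base = y ∧ Step e e' := by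
  obtain ⟨i, hi⟩ := e.isChart.surj y hy
  obtain ⟨ψ, hψ⟩ := hK.exists_chart y
  obtain ⟨χ, hχ, h1, h2⟩ := e.isChart.exists_continuation hψ hi (LatticeWord.flip e.word i).2
  exact ⟨⟨y, _, χ, valid_flip e.valid i, hχ⟩, rfl, i, hi, rfl, h1, h2⟩

theorem Step.unique {e e₁ e₂ : Development K} (h₁ : Step e e₁) (h₂ : Step e e₂)
    (h : e₁.base = e₂.base) : e₁ = e₂ := by
  obtain ⟨i, hi, hw, hc, hd⟩ := h₁
  obtain ⟨j, hj, hw', hc', hd'⟩ := h₂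
  obtain rfl := e.isChart.injective (hi.trans (h.trans hj.symm))
  obtain ⟨b, w, φ, _, hφ⟩ := e₁
  obtain ⟨b', w', φ', _, hφ'⟩ := e₂
  dsimp only at *
  subst h
  obtain rfl := hw.trans hw'.symm
  obtain rfl := hφ.eq_of_apply_eq hφ' _ (hc.trans hc'.symm) (hd.trans hd'.symm)
  rfl

/-- The cocycle condition on one side of the edge: `flip_triangle` says that the word and the index
reached through `e₁` are those reached directly. -/
theorem Step.triangle_aux {e e₁ e₂ : Development K} {i : Fin 8} (h₁ : e.chart i = e₁.base)
    (hw₁ : e₁.word = (LatticeWord.flip e.word i).1)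
    (hc₁ : e₁.chart (LatticeWord.flip e.word i).2 = e.base)
    (hd₁ : e₁.chart ((LatticeWord.flip e.word i).2 - 1) = e.chart (i + 1))
    (h₂ : Step e₁ e₂) (he₂ : e₂.base = e.chart (i + 1)) : Step e e₂ := by
  obtain ⟨j, hj, hw, hc, hd⟩ := h₂
  obtain rfl : j = (LatticeWord.flip e.word i).2 - 1 :=
    e₁.isChart.injective (hj.trans (he₂.trans hd₁.symm))
  have ht := flip_triangle e.valid i
  have hv := valid_flip e.valid (i + 1)
  have hf := flip_flip hv ((LatticeWord.flip e.word (i + 1)).2 + 1)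
  rw [ht, ← hw₁] at hf
  rw [hf] at hw hc hd
  rw [add_sub_cancel_right, sub_add_cancel, hc₁] at hd
  refine ⟨i + 1, he₂.symm, hw, hd, ?_⟩
  apply e.isChart.apply_sub_one_eq e₂.isChart he₂.symm hd
  rw [hc, ← h₁, add_sub_cancel_right]

theorem Step.triangle {e e₁ e₂ : Development K} (h₁ : Step e e₁) (h₂ : Step e₁ e₂)
    (hne : e.base ≠ e₂.base) (hf : {e.base, e₁.base, e₂.base} ∈ K.faces) : Step e e₂ := by
  have h₁' := h₁.symm
  obtain ⟨i, hi, hw, hc, hd⟩ := h₁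
  have hf' := hf
  rw [← hi] at hf'
  rcases e.isChart.eq_or_eq_of_face i (hi ▸ h₂.adj.1.symm) hne hf' with h | h
  · exact Step.triangle_aux hi hw hc hd h₂ h
  · obtain ⟨j, hj, hwj, hcj, hdj⟩ := h₂
    have hi' := e.isChart.apply_add_one_eq e₁.isChart hi hc hd
    obtain rfl : j = (LatticeWord.flip e.word i).2 + 1 :=
      e₁.isChart.injective (hj.trans (h.trans hi'.symm))
    have ha := e₁.isChart.apply_add_one_eq e₂.isChart hj hcj hdj
    have hff := flip_flip e₁.valid ((LatticeWord.flip e.word i).2 + 1)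
    rw [← hwj] at hff
    -- On the other side, the reversed path `e₂`, `e₁`, `e` has its third vertex at index `+ 1`, so
    -- the previous case applies.
    refine (Step.triangle_aux hcj (by rw [hff]) (by rw [hff]; exact hj) ?_ h₁' ?_).symm
    · rw [hff]; exact ha.symm
    · rw [ha, add_sub_cancel_right, hc]

end Development

/-- A consistent labelling of the vertices of a complex by vertices of the word model, together
with charts. -/
structure IsDeveloping (K : AbstractSimplicialComplex V) (o : V) (w : V → List ℕ)
    (φ : V → Fin 8 → V) : Prop where
  root : w o = []
  valid : ∀ x, Valid (w x)
  isChart : ∀ x, IsChart K x (φ x)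
  word_apply : ∀ x i, w (φ x i) = (LatticeWord.flip (w x) i).1
  apply_flip : ∀ x i, φ (φ x i) (LatticeWord.flip (w x) i).2 = x
  apply_flip_sub_one : ∀ x i, φ (φ x i) ((LatticeWord.flip (w x) i).2 - 1) = φ x (i + 1)

theorem IsEquilateralLattice.exists_isDeveloping (hK : K.IsEquilateralLattice 8) (o : V) :
    ∃ w φ, IsDeveloping K o w φ := by
  obtain ⟨φ₀, hφ₀⟩ := hK.exists_chart o
  let e₀ : Development K := ⟨o, [], φ₀, trivial, hφ₀⟩
  obtain ⟨s, hs, hs₀, hstep⟩ := hK.toIsTriangulatedPlane.exists_section (π := Development.base)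
    (R := Development.Step) (fun _ _ => Development.Step.symm) (fun _ _ => Development.Step.adj)
    (fun e _ => e.exists_step hK) (fun _ _ _ => Development.Step.unique)
    (fun _ _ _ => Development.Step.triangle) e₀
  have hchart : ∀ x, IsChart K x (s x).chart := by
    intro x
    have := (s x).isChart
    rwa [hs] at this
  have key : ∀ x i, (s ((s x).chart i)).word = (LatticeWord.flip (s x).word i).1 ∧
      (s ((s x).chart i)).chart (LatticeWord.flip (s x).word i).2 = x ∧
      (s ((s x).chart i)).chart ((LatticeWord.flip (s x).word i).2 - 1) =
        (s x).chart (i + 1) := by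
    intro x i
    obtain ⟨j, hj, hw, hc, hd⟩ := hstep x _ ((hchart x).adj i)
    rw [hs] at hj hc
    obtain rfl := (hchart x).injective hj
    exact ⟨hw, hc, hd⟩
  exact ⟨fun x => (s x).word, fun x => (s x).chart, congrArg Development.word hs₀,
    fun x => (s x).valid, hchart, fun x i => (key x i).1, fun x i => (key x i).2.1,
    fun x i => (key x i).2.2⟩

end AbstractSimplicialComplex

/-! ### Effect of the gluing rules on word length. -/

namespace LatticeWord

variable {m v : List ℕ}

theorem val_ofNat_arity_add (hm : m ≠ []) {a : ℕ} (ha : a ≤ 2) :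
    (Fin.ofNat 8 (arity m + a)).val = arity m + a := by
  have := arity_eq_of_ne_nil hm
  rw [Fin.val_ofNat, Nat.mod_eq_of_lt (by omega)]

theorem length_flip_of_le {i : Fin 8} (hi : i.val ≤ arity m) :
    (flip m i).1.length = m.length + 1 := by
  rcases m with _ | ⟨t, v⟩
  · rfl
  rcases Nat.eq_zero_or_pos i.val with h | h
  · obtain rfl : i = 0 := Fin.ext h
    rw [flip_zero (by simp)]; rfl
  rcases hi.lt_or_eq with h' | h'
  · rw [flip_child h h']; rfl
  · rw [flip_arity (by simp) h']; simp

theorem length_flip_next (hm : m ≠ []) {i : Fin 8} (hi : i.val = arity m + 1) :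
    (flip m i).1.length = m.length := by
  rw [flip_next hm hi]; simp

theorem length_flip_seven (hm : m ≠ []) : (flip m 7).1.length = m.length := by
  rw [flip_seven hm]; simp

theorem length_flip_parent (hm : m ≠ []) {i : Fin 8} (hi : arity m + 2 ≤ i.val) (h7 : i.val < 7) :
    (flip m i).1.length + 1 = m.length := by
  rcases m with _ | ⟨t, v⟩
  · simp at hm
  have := arity_eq_of_ne_nil hm
  rcases index_cases (t := t) (v := v) i with rfl | ⟨h0, h⟩ | h | h | h | rfl | ⟨rfl, rfl, hv⟩
  · simp at hi
  · omega
  · omega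
  · omega
  · rw [flip_parent h]; rfl
  · simp at h7
  · rw [flip_zero_cons_six hv]; simp

theorem length_flip_le (m : List ℕ) (i : Fin 8) : (flip m i).1.length ≤ m.length + 1 := by
  by_cases hm : m = []
  · subst hm; rfl
  have := i.2
  rcases Nat.lt_or_ge (arity m) i.val with h | h
  · by_cases h1 : i.val = arity m + 1
    · rw [length_flip_next hm h1]; omega
    by_cases h7 : i.val = 7
    · obtain rfl : i = 7 := Fin.ext h7
      rw [length_flip_seven hm]; omega
    · have := length_flip_parent hm (i := i) (by omega) (by omega)
      omega
  · rw [length_flip_of_le h]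

end LatticeWord

namespace AbstractSimplicialComplex

variable {V : Type*} [DecidableEq V] {K : AbstractSimplicialComplex V}

open LatticeWord

/-! ### The layers of a developed complex -/

namespace IsDeveloping

variable {o : V} {w : V → List ℕ} {φ : V → Fin 8 → V}

/-- The parent of a vertex (the second one, if there are two). -/
def parent (w : V → List ℕ) (φ : V → Fin 8 → V) (x : V) : V :=
  φ x (Fin.ofNat 8 (arity (w x) + 2))

/-- The successor of a vertex in the cyclic order of its layer. -/
def succ (w : V → List ℕ) (φ : V → Fin 8 → V) (x : V) : V :=
  φ x (Fin.ofNat 8 (arity (w x) + 1))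

/-- The ancestor of a vertex in the initial layer. -/
def ancestor (w : V → List ℕ) (φ : V → Fin 8 → V) (x : V) : V :=
  (parent w φ)^[(w x).length] x

variable (hD : IsDeveloping K o w φ)
include hD

theorem adj_apply (x : V) (i : Fin 8) : K.edgeGraph.Adj x (φ x i) := (hD.isChart x).adj i

theorem adj_apply_apply_add_one (x : V) (i : Fin 8) : K.edgeGraph.Adj (φ x i) (φ x (i + 1)) :=
  adj_of_mem_faces ((hD.isChart x).face i) (by simp) (by simp)
    ((hD.isChart x).injective.ne ((hD.isChart x).add_one_ne i).symm)

theorem length_parent {x : V} (hx : w x ≠ []) : (w (parent w φ x)).length + 1 = (w x).length := by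
  have h := arity_eq_of_ne_nil hx
  have hv := val_ofNat_arity_add hx le_rfl
  rw [parent, hD.word_apply]
  exact length_flip_parent hx hv.ge (by omega)

theorem word_succ {x : V} (hx : w x ≠ []) : w (succ w φ x) = next (w x) := by
  rw [succ, hD.word_apply, flip_next hx (val_ofNat_arity_add hx (by norm_num))]

/-- A vertex, its successor and its parent span a triangle. Index 6 at the successor is its only
parent if its arity is 4, and the other one of two parents if its arity is 3. -/
theorem apply_succ_six {x : V} (hx : w x ≠ []) : φ (succ w φ x) 6 = parent w φ x := by
  have h := hD.apply_flip_sub_one x (Fin.ofNat 8 (arity (w x) + 1))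
  rw [flip_next hx (val_ofNat_arity_add hx (by norm_num))] at h
  rw [parent, show Fin.ofNat 8 (arity (w x) + 2) = Fin.ofNat 8 (arity (w x) + 1) + 1 by
    ext; simp [Fin.val_add]]
  exact h

theorem succ_apply_seven {x : V} (hx : w x ≠ []) : succ w φ (φ x 7) = x := by
  have h := hD.apply_flip x 7
  rw [flip_seven hx] at h
  rw [succ, hD.word_apply, flip_seven hx]
  exact h

theorem ancestor_parent {x : V} (hx : w x ≠ []) :
    ancestor w φ (parent w φ x) = ancestor w φ x := by
  rw [ancestor, ancestor, ← hD.length_parent hx, Function.iterate_succ_apply]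

/-- The parents of two consecutive vertices coincide or are adjacent one layer down, where the
induction hypothesis applies. -/
theorem ancestor_succ {x : V} (hx : w x ≠ [])
    (ih : ∀ y z, K.edgeGraph.Adj y z → (w y).length < (w x).length →
      (w z).length < (w x).length → ancestor w φ y = ancestor w φ z) :
    ancestor w φ (succ w φ x) = ancestor w φ x := by
  have hs : w (succ w φ x) ≠ [] := by rw [hD.word_succ hx]; exact next_ne_nil hx
  have hl : (w (succ w φ x)).length = (w x).length := by rw [hD.word_succ hx]; simp
  have h1 := hD.length_parent hx
  have h2 := hD.length_parent hs
  rw [← hD.ancestor_parent hx, ← hD.ancestor_parent hs]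
  rcases arity_eq_of_ne_nil hs with h | h
  · refine ih _ _ ?_ (by omega) (by omega)
    rw [← hD.apply_succ_six hx, parent, h]
    exact hD.adj_apply_apply_add_one _ 5
  · rw [← hD.apply_succ_six hx, parent, h]
    rfl

theorem ancestor_eq_of_adj {x y : V} (h : K.edgeGraph.Adj x y) :
    ancestor w φ x = ancestor w φ y := by
  obtain ⟨n, hn⟩ : ∃ n, max (w x).length (w y).length ≤ n := ⟨_, le_rfl⟩
  induction n using Nat.strong_induction_on generalizing x y with
  | _ n ih =>
  wlog hxy : (w y).length ≤ (w x).length generalizing x y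
  · exact (this h.symm (by rwa [max_comm]) (by omega)).symm
  obtain ⟨i, rfl⟩ := (hD.isChart x).surj y h
  have hle : ¬ i.val ≤ arity (w x) := by
    intro hi
    rw [hD.word_apply, length_flip_of_le hi] at hxy
    omega
  have hx : w x ≠ [] := by
    rintro h
    rw [h] at hle
    exact hle i.2.le
  have ih' : ∀ y z, K.edgeGraph.Adj y z → (w y).length < (w x).length →
      (w z).length < (w x).length → ancestor w φ y = ancestor w φ z := fun y z hyz hy hz =>
    ih _ (by omega) hyz le_rfl
  obtain ⟨t, v, htv⟩ := List.exists_cons_of_ne_nil hx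
  rw [htv] at hle
  rcases index_cases (t := t) (v := v) i with rfl | ⟨h0, h⟩ | h | h | h | rfl | ⟨rfl, rfl, hv⟩
  · simp at hle
  · omega
  · omega
  · have e : φ x i = succ w φ x := by rw [succ, htv, ofNat_eq h]
    rw [e, hD.ancestor_succ hx ih']
  · have e : φ x i = parent w φ x := by rw [parent, htv, ofNat_eq h]
    rw [e, hD.ancestor_parent hx]
  · have h7 : w (φ x 7) = prev (w x) := by rw [hD.word_apply, flip_seven hx]
    have := hD.ancestor_succ (x := φ x 7) (by rw [h7]; exact prev_ne_nil hx)
      (by rw [h7, length_prev]; exact ih')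
    rwa [hD.succ_apply_seven hx] at this
  · have e : parent w φ x = φ x 5 := by rw [parent, htv, arity_zero_cons hv]; rfl
    have h1 := hD.length_parent hx
    have h2 := length_flip_parent hx (i := 6) (by rw [htv, arity_zero_cons hv]; simp) (by simp)
    rw [← hD.word_apply] at h2
    rw [← hD.ancestor_parent hx]
    refine ih' _ _ ?_ (by omega) (by omega)
    rw [e]
    exact hD.adj_apply_apply_add_one _ 5

/-- The ancestor is constant along edges, hence constant on the connected complex, and a vertex with
empty word is its own ancestor. This is the only injectivity property of `w` that is needed. -/
theorem eq_of_word_eq_nil (hK : K.edgeGraph.Connected) {x : V} (hx : w x = []) : x = o := by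
  obtain ⟨p⟩ := hK x o
  have : ancestor w φ x = ancestor w φ o := by
    clear hx
    induction p with
    | nil => rfl
    | cons h _ ih => exact (hD.ancestor_eq_of_adj h).trans (ih hD)
  simpa [ancestor, hx, hD.root] using this

theorem length_le_of_adj {x y : V} (h : K.edgeGraph.Adj x y) :
    (w y).length ≤ (w x).length + 1 := by
  obtain ⟨i, rfl⟩ := (hD.isChart x).surj y h
  rw [hD.word_apply]
  exact length_flip_le _ _

/-- Descending through parents gives a path of length `(w x).length`; conversely an edge raises the
word length by at most one. -/
theorem dist_eq (hK : K.edgeGraph.Connected) (x : V) : K.edgeGraph.dist o x = (w x).length := by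
  refine le_antisymm ?_ ?_
  · obtain ⟨n, hn⟩ : ∃ n, (w x).length = n := ⟨_, rfl⟩
    rw [hn]
    induction n generalizing x with
    | zero =>
      rw [hD.eq_of_word_eq_nil hK (List.length_eq_zero_iff.1 hn), SimpleGraph.dist_self]
    | succ n ih =>
      have hx : w x ≠ [] := by rintro h; simp [h] at hn
      have h1 := ih (parent w φ x) (by have := hD.length_parent hx; omega)
      have h2 : K.edgeGraph.dist x (parent w φ x) = 1 :=
        SimpleGraph.dist_eq_one_iff_adj.2 (hD.adj_apply x _)
      rw [SimpleGraph.dist_comm] at h2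
      have := hK.dist_triangle (u := o) (v := parent w φ x) (w := x)
      omega
  · obtain ⟨p, hp⟩ := hK.exists_walk_length_eq_dist o x
    rw [← hp]
    have : ∀ {y z : V} (p : K.edgeGraph.Walk y z), (w z).length ≤ (w y).length + p.length := by
      intro y z p
      induction p with
      | nil => simp
      | cons h _ ih =>
        have := hD.length_le_of_adj h
        rw [SimpleGraph.Walk.length_cons]
        omega
    have h := this p
    rwa [hD.root, List.length_nil, zero_add] at h

end IsDeveloping

end AbstractSimplicialComplex

namespace AbstractSimplicialComplex

variable {V : Type*} [DecidableEq V] {K : AbstractSimplicialComplex V}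

open LatticeWord

/-! ### The colouring around a vertex -/

/-- The triangles around a vertex alternate in colour. -/
theorem IsChart.black_add_one_iff {x : V} {m : ℕ} [NeZero m] {φ : Fin m → V} (hφ : IsChart K x φ)
    (c : K.BWColoring) (i : Fin m) :
    {x, φ (i + 1), φ (i + 1 + 1)} ∈ c.black ↔ {x, φ i, φ (i + 1)} ∉ c.black := by
  have h := c.opposite _ (hφ.triangle_mem i) _ (hφ.triangle_mem (i + 1)) ?_
  · rw [h, not_not]
  apply le_antisymm
  · by_contra! hlt
    have h1 := Finset.eq_of_subset_of_card_le
      (Finset.inter_subset_left (s₁ := {x, φ i, φ (i + 1)}) (s₂ := {x, φ (i + 1), φ (i + 1 + 1)}))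
      (by rw [hφ.card_triangle]; omega)
    have h2 := Finset.eq_of_subset_of_card_le (Finset.inter_eq_left.1 h1)
      (by rw [hφ.card_triangle, hφ.card_triangle])
    exact hφ.add_one_ne i (hφ.triangle_injective h2).symm
  · rw [← Finset.card_pair (hφ.adj (i + 1)).1]
    exact Finset.card_le_card (by intro y; simp; tauto)

namespace IsDeveloping

variable {o : V} {w : V → List ℕ} {φ : V → Fin 8 → V} (hD : IsDeveloping K o w φ)
include hD

theorem black_add_one_iff (c : K.BWColoring) (x : V) (i : Fin 8) :
    {x, φ x (i + 1), φ x (i + 1 + 1)} ∈ c.black ↔ {x, φ x i, φ x (i + 1)} ∉ c.black :=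
  (hD.isChart x).black_add_one_iff c i

theorem length_apply_le_iff (x : V) (i : Fin 8) :
    (w (φ x i)).length ≤ (w x).length ↔ arity (w x) < i.val := by
  rw [hD.word_apply]
  constructor
  · intro h
    by_contra! hi
    rw [length_flip_of_le hi] at h
    omega
  · intro hi
    have hx : w x ≠ [] := by
      rintro h
      rw [h] at hi
      have := i.2
      simp only [arity] at hi
      omega
    by_cases h1 : i.val = arity (w x) + 1
    · rw [length_flip_next hx h1]
    by_cases h7 : i.val = 7
    · obtain rfl : i = 7 := Fin.ext h7
      rw [length_flip_seven hx]
    · have := length_flip_parent hx (i := i) (by omega) (by omega)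
      omega

theorem length_apply_eq_iff {x : V} (hx : w x ≠ []) (i : Fin 8) :
    (w (φ x i)).length = (w x).length ↔ i.val = arity (w x) + 1 ∨ i.val = 7 := by
  constructor
  · intro h
    have h1 := (hD.length_apply_le_iff x i).1 h.le
    by_contra! hi
    have := length_flip_parent hx (i := i) (by omega) (by omega)
    rw [← hD.word_apply] at this
    omega
  · rw [hD.word_apply]
    rintro (h | h)
    · exact length_flip_next hx h
    · obtain rfl : i = 7 := Fin.ext h
      exact length_flip_seven hx

theorem mem_ball (hK : K.edgeGraph.Connected) {x : V} {n : ℕ} :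
    x ∈ K.ball o n ↔ (w x).length ≤ n := by
  rw [← hD.dist_eq hK]; rfl

theorem mem_ballBoundary (hK : K.edgeGraph.Connected) {x : V} {n : ℕ} :
    x ∈ K.ballBoundary o n ↔ (w x).length = n := by
  rw [← hD.dist_eq hK]; rfl

/-- Every vertex has a black triangle whose other vertices lie in the next layer. -/
theorem exists_black_up (c : K.BWColoring) (x : V) :
    ∃ y z, {x, y, z} ∈ c.black ∧ (w y).length = (w x).length + 1 ∧
      (w z).length = (w x).length + 1 := by
  have h3 := three_le_arity (w x)
  have hl : ∀ i : Fin 8, i.val ≤ 3 → (w (φ x i)).length = (w x).length + 1 := by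
    intro i hi
    rw [hD.word_apply, length_flip_of_le (by omega)]
  have h := hD.black_add_one_iff c x 0
  by_cases hb : {x, φ x 0, φ x (0 + 1)} ∈ c.black
  · exact ⟨_, _, hb, hl _ (by decide), hl _ (by decide)⟩
  · exact ⟨_, _, h.2 hb, hl _ (by decide), hl _ (by decide)⟩

/-- Triangle 7 is excluded because its last vertex has index `7 + 1 = 0`, a child. -/
theorem triangle_subset_ball_iff (hK : K.edgeGraph.Connected) (x : V) (i : Fin 8) :
    ((({x, φ x i, φ x (i + 1)} : Finset V) : Set V) ⊆ K.ball o (w x).length) ↔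
      arity (w x) < i.val ∧ i.val ≤ 6 := by
  have h8 := three_le_arity (w x)
  simp only [Finset.coe_insert, Finset.coe_singleton, Set.insert_subset_iff,
    Set.singleton_subset_iff, hD.mem_ball hK, hD.length_apply_le_iff, le_refl, true_and]
  rcases Nat.lt_or_ge i.val 7 with h | h
  · rw [Fin.val_add_one_of_lt' (by omega)]
    omega
  · obtain rfl : i = 7 := Fin.ext (by have := i.2; omega)
    simp

/-- A black triangle of a ball that reaches the boundary contains a boundary vertex that belongs to
no other black triangle of the ball. -/
theorem exists_pivot (hK : K.edgeGraph.Connected) (c : K.BWColoring) {n : ℕ} {T : Finset V}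
    (hT : T ∈ c.blackIn (K.ball o (n + 1))) {x : V} (hxT : x ∈ T) (hx : (w x).length = n + 1) :
    ∃ p ∈ T, (w p).length = n + 1 ∧ ∀ T' ∈ c.blackIn (K.ball o (n + 1)), p ∈ T' → T' = T := by
  have key : ∀ p, (w p).length = n + 1 → ∀ T ∈ c.blackIn (K.ball o (n + 1)), p ∈ T →
      ∃ i : Fin 8, T = {p, φ p i, φ p (i + 1)} ∧ arity (w p) < i.val ∧ i.val ≤ 6 := by
    intro p hp T hT hpT
    obtain ⟨i, rfl⟩ := (hD.isChart p).exists_eq_triangle (c.black_subset hT.1) hpT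
    refine ⟨i, rfl, ?_⟩
    rw [← hD.triangle_subset_ball_iff hK, hp]
    exact hT.2
  -- With one parent, only the consecutive triangles 5 and 6 lie in the ball, and exactly one of
  -- them is black.
  have hfour : ∀ p, (w p).length = n + 1 → arity (w p) = 4 → p ∈ T → ∃ p ∈ T,
      (w p).length = n + 1 ∧ ∀ T' ∈ c.blackIn (K.ball o (n + 1)), p ∈ T' → T' = T := by
    intro p hp h4 hpT
    refine ⟨p, hpT, hp, fun T' hT' hpT' => ?_⟩
    obtain ⟨i, rfl, hi⟩ := key p hp T hT hpT
    obtain ⟨j, rfl, hj⟩ := key p hp T' hT' hpT'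
    have h := hD.black_add_one_iff c p 5
    have hi' : i = 5 ∨ i = 5 + 1 := by simp only [Fin.ext_iff]; simp; omega
    have hj' : j = 5 ∨ j = 5 + 1 := by simp only [Fin.ext_iff]; simp; omega
    rcases hi' with rfl | rfl <;> rcases hj' with rfl | rfl
    · rfl
    · exact absurd hT.1 (h.1 hT'.1)
    · exact absurd hT'.1 (h.1 hT.1)
    · rfl
  have hx0 := List.ne_nil_of_length_eq_add_one hx
  rcases arity_eq_of_ne_nil hx0 with h3 | h4
  swap
  · exact hfour x hx h4 hxT
  obtain ⟨i, rfl, hi⟩ := key x hx T hT hxT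
  have hi' : i = 4 ∨ i = 5 ∨ i = 6 := by simp only [Fin.ext_iff]; simp; omega
  obtain ⟨t, v, htv⟩ := List.exists_cons_of_ne_nil hx0
  obtain rfl : t = 0 := by
    by_contra h
    rw [htv, arity_cons_of_pos (Nat.pos_of_ne_zero h)] at h3
    omega
  rcases hi' with rfl | rfl | rfl
  -- Triangle 4 contains the successor of `x`. As `x` is a first child, its successor is not, so it
  -- has arity 4 and serves as pivot.
  · refine hfour (φ x 4) ?_ ?_ (by simp)
    · rw [(hD.length_apply_eq_iff hx0 4).2 (by rw [h3]; simp), hx]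
    · rw [hD.word_apply, flip_next hx0 (by rw [h3]; rfl), htv, next]
      have hlt := hD.valid x
      rw [htv] at hlt
      have := three_le_arity v
      rw [if_pos (by omega), arity_succ_cons]
  -- If the middle triangle 5 is black, then 4 and 6 are white and `x` itself is the pivot.
  · refine ⟨x, hxT, hx, fun T' hT' hpT' => ?_⟩
    obtain ⟨j, rfl, hj⟩ := key x hx T' hT' hpT'
    have hj' : j = 4 ∨ j = 5 ∨ j = 6 := by simp only [Fin.ext_iff]; simp; omega
    rcases hj' with rfl | rfl | rfl
    · exact absurd hT'.1 ((hD.black_add_one_iff c x 4).1 hT.1)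
    · rfl
    · exact absurd hT.1 ((hD.black_add_one_iff c x 5).1 hT'.1)
  -- Triangle 6 contains the predecessor, a last own child, again of arity 4.
  · refine hfour (φ x 7) ?_ ?_ (by simp)
    · rw [(hD.length_apply_eq_iff hx0 7).2 (by simp), hx]
    · rw [hD.word_apply, flip_seven hx0, htv, prev]
      have := three_le_arity (prev v)
      exact arity_cons_of_pos (by omega) _

theorem finite_ball (hK : K.edgeGraph.Connected) (n : ℕ) : (K.ball o n).Finite := by
  induction n with
  | zero =>
    refine (Set.finite_singleton o).subset fun x hx => ?_
    rw [hD.mem_ball hK, Nat.le_zero, List.length_eq_zero_iff] at hx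
    exact hD.eq_of_word_eq_nil hK hx
  | succ n ih =>
    refine (ih.union (ih.biUnion fun x _ => Set.finite_range (φ x))).subset fun x hx => ?_
    rw [hD.mem_ball hK] at hx
    by_cases h0 : w x = []
    · left
      rw [hD.mem_ball hK, h0]
      exact Nat.zero_le _
    · right
      have h1 := hD.length_parent h0
      obtain ⟨i, hi⟩ := (hD.isChart (parent w φ x)).surj x (hD.adj_apply x _).symm
      refine Set.mem_biUnion ((hD.mem_ball hK).2 ?_) ⟨i, hi⟩
      omega

end IsDeveloping

theorem BWColoring.finite_blackIn (c : K.BWColoring) {D : Set V} (hD : D.Finite) :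
    (c.blackIn D).Finite := by
  refine (Finset.finite_toSet hD.toFinset.powerset).subset fun T hT => ?_
  rw [Finset.mem_coe, Finset.mem_powerset]
  intro x hx
  rw [Set.Finite.mem_toFinset]
  exact hT.2 hx

end AbstractSimplicialComplex

namespace AbstractSimplicialComplex

variable {V : Type*} [DecidableEq V] {K : AbstractSimplicialComplex V}

open LatticeWord

/-! ### Counting vertices and black triangles -/

namespace IsDeveloping

variable {o : V} {w : V → List ℕ} {φ : V → Fin 8 → V} (hD : IsDeveloping K o w φ)
include hD

theorem finite_ballBoundary (hK : K.edgeGraph.Connected) (n : ℕ) : (K.ballBoundary o n).Finite :=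
  (hD.finite_ball hK n).subset (K.ballBoundary_subset_ball o n)

theorem ncard_ball_succ (hK : K.edgeGraph.Connected) (n : ℕ) :
    (K.ball o (n + 1)).ncard = (K.ball o n).ncard + (K.ballBoundary o (n + 1)).ncard := by
  rw [← Set.ncard_union_eq _ (hD.finite_ball hK n) (hD.finite_ballBoundary hK _)]
  · congr 1
    ext x
    simp only [Set.mem_union, hD.mem_ball hK, hD.mem_ballBoundary hK]
    omega
  · rw [Set.disjoint_left]
    intro x
    rw [hD.mem_ball hK, hD.mem_ballBoundary hK]
    omega

theorem ncard_blackIn_succ (hK : K.edgeGraph.Connected) (c : K.BWColoring) (n : ℕ) :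
    (c.blackIn (K.ball o (n + 1))).ncard = (c.blackIn (K.ball o n)).ncard +
      {T ∈ c.blackIn (K.ball o (n + 1)) | ∃ x ∈ T, (w x).length = n + 1}.ncard := by
  have hfin := c.finite_blackIn (hD.finite_ball hK (n + 1))
  rw [← Set.ncard_union_eq _ (c.finite_blackIn (hD.finite_ball hK n))
    (hfin.subset fun T hT => hT.1)]
  · congr 1
    ext T
    simp only [BWColoring.blackIn, Set.mem_union, Set.mem_ofPred_eq, Set.subset_def,
      Finset.mem_coe, hD.mem_ball hK]
    constructor
    · rintro ⟨hT, h⟩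
      by_cases hx : ∃ x ∈ T, (w x).length = n + 1
      · exact .inr ⟨⟨hT, h⟩, hx⟩
      · push Not at hx
        exact .inl ⟨hT, fun x hxT => by have := h x hxT; have := hx x hxT; omega⟩
    · rintro (⟨hT, h⟩ | ⟨h, -⟩)
      · exact ⟨hT, fun x hx => (h x hx).trans n.le_succ⟩
      · exact h
  · rw [Set.disjoint_left]
    rintro T ⟨-, hT⟩ ⟨-, x, hx, h⟩
    have := (hD.mem_ball hK).1 (hT hx)
    omega

/-- The number of vertices of the triangle number `i` around `x` that lie in the layer of `x`. -/
theorem card_filter_triangle {x : V} (hx : w x ≠ []) (i : Fin 8) :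
    (({x, φ x i, φ x (i + 1)} : Finset V).filter fun y => (w y).length = (w x).length).card =
      1 + (if i.val = arity (w x) + 1 ∨ i.val = 7 then 1 else 0) +
      (if (i + 1).val = arity (w x) + 1 ∨ (i + 1).val = 7 then 1 else 0) := by
  have h1 := (hD.adj_apply x i).1
  have h2 := (hD.adj_apply x (i + 1)).1
  have h3 := (hD.adj_apply_apply_add_one x i).1
  rw [Finset.card_filter, Finset.sum_insert (by simp [h1, h2]), Finset.sum_pair h3]
  simp only [hD.length_apply_eq_iff hx, if_true, add_assoc]

/-- Each boundary vertex of a ball contributes one or two to the doubled number of black triangles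
of the ball that reach the boundary. -/
theorem sum_black_at (hK : K.edgeGraph.Connected) (c : K.BWColoring) {n : ℕ} {x : V}
    (hx : (w x).length = n + 1) (S : Finset (Finset V))
    (hS : ∀ T, T ∈ S ↔ T ∈ c.blackIn (K.ball o (n + 1)) ∧ ∃ x ∈ T, (w x).length = n + 1) :
    ∑ T ∈ S with x ∈ T, (2 : ℚ) / ((T.filter fun y => (w y).length = n + 1).card : ℚ) =
      if arity (w x) = 3 then 2 else 1 := by
  classical
  have hx0 := List.ne_nil_of_length_eq_add_one hx
  have hSx : S.filter (x ∈ ·) = (Finset.univ.filter fun i : Fin 8 =>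
      (arity (w x) < i.val ∧ i.val ≤ 6) ∧ {x, φ x i, φ x (i + 1)} ∈ c.black).image
      fun i => {x, φ x i, φ x (i + 1)} := by
    ext T
    rw [Finset.mem_filter, hS, Finset.mem_image]
    simp only [Finset.mem_filter, Finset.mem_univ, true_and]
    constructor
    · rintro ⟨⟨hT, -⟩, hxT⟩
      obtain ⟨i, rfl⟩ := (hD.isChart x).exists_eq_triangle (c.black_subset hT.1) hxT
      refine ⟨i, ⟨?_, hT.1⟩, rfl⟩
      rw [← hD.triangle_subset_ball_iff hK, hx]
      exact hT.2
    · rintro ⟨i, ⟨hi, hb⟩, rfl⟩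
      rw [← hD.triangle_subset_ball_iff hK, hx] at hi
      exact ⟨⟨⟨hb, hi⟩, x, by simp, hx⟩, by simp⟩
  rw [hSx, Finset.sum_image fun i _ j _ h => (hD.isChart x).triangle_injective h,
    Finset.sum_filter]
  simp_rw [← hx, hD.card_filter_triangle hx0]
  have h4 := hD.black_add_one_iff c x 4
  have h5 := hD.black_add_one_iff c x 5
  rw [show (4 : Fin 8) + 1 = 5 from rfl] at h4
  rw [show (5 : Fin 8) + 1 = 6 from rfl] at h5 h4
  rw [show (6 : Fin 8) + 1 = 7 from rfl] at h5
  rcases arity_eq_of_ne_nil hx0 with h | h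
  -- Two parents: either triangle 5 is black, with `x` as its only boundary vertex and weight 2, or
  -- 4 and 6 are black, with two boundary vertices each and weights `1 + 1`.
  · rw [h]
    by_cases hb : {x, φ x 4, φ x 5} ∈ c.black <;>
      (simp [Fin.sum_univ_eight, hb, h4, h5]; try norm_num)
  · rw [h]
    by_cases hb : {x, φ x 5, φ x 6} ∈ c.black <;>
      (simp [Fin.sum_univ_eight, hb, h5]; norm_num)

/-- The doubled number of black triangles of a ball that reach the boundary. -/
theorem two_mul_ncard_black (hK : K.edgeGraph.Connected) (c : K.BWColoring) (n : ℕ) :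
    2 * {T ∈ c.blackIn (K.ball o (n + 1)) | ∃ x ∈ T, (w x).length = n + 1}.ncard =
      (K.ballBoundary o (n + 1)).ncard +
        {x ∈ K.ballBoundary o (n + 1) | arity (w x) = 3}.ncard := by
  classical
  have hfin := (c.finite_blackIn (hD.finite_ball hK (n + 1))).subset
    (fun T hT => hT.1 : {T ∈ c.blackIn (K.ball o (n + 1)) | ∃ x ∈ T, (w x).length = n + 1} ⊆ _)
  have hL := hD.finite_ballBoundary hK (n + 1)
  have hL3 := hL.subset
    (fun x hx => hx.1 : {x ∈ K.ballBoundary o (n + 1) | arity (w x) = 3} ⊆ _)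
  rw [Set.ncard_eq_toFinset_card _ hfin, Set.ncard_eq_toFinset_card _ hL,
    Set.ncard_eq_toFinset_card _ hL3]
  have hS : ∀ T, T ∈ hfin.toFinset ↔
      T ∈ c.blackIn (K.ball o (n + 1)) ∧ ∃ x ∈ T, (w x).length = n + 1 := fun T => by simp
  have hmem : ∀ x, x ∈ hL.toFinset ↔ (w x).length = n + 1 := fun x => by
    rw [Set.Finite.mem_toFinset, hD.mem_ballBoundary hK]
  have h3 : hL3.toFinset = hL.toFinset.filter fun x => arity (w x) = 3 := by
    ext x; simp
  rw [h3]
  generalize hfin.toFinset = S at hS ⊢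
  generalize hL.toFinset = L at hmem ⊢
  -- Double counting: each triangle spreads weight 2 equally over its vertices in the layer.
  have h1 : ∑ x ∈ L, ∑ T ∈ S with x ∈ T,
      (2 : ℚ) / ((T.filter fun y => (w y).length = n + 1).card : ℚ) =
      ∑ x ∈ L, if arity (w x) = 3 then 2 else 1 :=
    Finset.sum_congr rfl fun x hx => hD.sum_black_at hK c ((hmem x).1 hx) S hS
  have h2 : ∑ x ∈ L, ∑ T ∈ S with x ∈ T,
      (2 : ℚ) / ((T.filter fun y => (w y).length = n + 1).card : ℚ) =
      ∑ T ∈ S, 2 := by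
    rw [Finset.sum_comm' (t' := S) (s' := fun T => T.filter fun y => (w y).length = n + 1)]
    · refine Finset.sum_congr rfl fun T hT => ?_
      obtain ⟨-, x, hxT, hx⟩ := (hS T).1 hT
      have hpos : 0 < (T.filter fun y => (w y).length = n + 1).card :=
        Finset.card_pos.2 ⟨x, Finset.mem_filter.2 ⟨hxT, hx⟩⟩
      rw [Finset.sum_const, nsmul_eq_mul]
      field_simp
    · intro x T
      rw [hmem, Finset.mem_filter, Finset.mem_filter]
      tauto
  have h3 : ∀ x, (if arity (w x) = 3 then (2 : ℚ) else 1) =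
      1 + if arity (w x) = 3 then 1 else 0 := fun x => by split_ifs <;> norm_num
  rw [h2, Finset.sum_congr rfl fun x _ => h3 x, Finset.sum_add_distrib, Finset.sum_boole] at h1
  simp only [Finset.sum_const, nsmul_eq_mul, mul_one] at h1
  rw [mul_comm]
  exact_mod_cast h1

/-- The vertices of a layer with two parents correspond to the vertices of the preceding layer. -/
theorem ncard_arity_eq_three (hK : K.edgeGraph.Connected) (n : ℕ) :
    {x ∈ K.ballBoundary o (n + 2) | arity (w x) = 3}.ncard =
      (K.ballBoundary o (n + 1)).ncard := by
  have h5 : ∀ x, w x ≠ [] → φ (φ x 0) 5 = x := fun x hx => by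
    have := hD.apply_flip x 0
    rwa [flip_zero hx] at this
  symm
  -- The bijection sends a vertex to its first child; the inverse is `φ · 5`, since the parent of a
  -- vertex of arity 3 has index `3 + 2`.
  refine Set.ncard_congr (fun x _ => φ x 0) ?_ ?_ ?_
  · intro x hx
    rw [hD.mem_ballBoundary hK] at hx
    have hx0 := List.ne_nil_of_length_eq_add_one hx
    refine ⟨(hD.mem_ballBoundary hK).2 ?_, ?_⟩
    · rw [hD.word_apply, length_flip_of_le (by simp), hx]
    · rw [hD.word_apply, flip_zero hx0, arity_zero_cons hx0]
  · intro x y hx hy h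
    rw [hD.mem_ballBoundary hK] at hx hy
    rw [← h5 x (List.ne_nil_of_length_eq_add_one hx), h,
      h5 y (List.ne_nil_of_length_eq_add_one hy)]
  · rintro y ⟨hy, h3⟩
    rw [hD.mem_ballBoundary hK] at hy
    have hy0 := List.ne_nil_of_length_eq_add_one hy
    obtain ⟨t, v, htv⟩ := List.exists_cons_of_ne_nil hy0
    obtain rfl : t = 0 := by
      by_contra h
      rw [htv, arity_cons_of_pos (Nat.pos_of_ne_zero h)] at h3
      omega
    have hflip : LatticeWord.flip (w y) 5 = (v, 0) := by
      rw [htv] at h3 ⊢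
      exact flip_parent (by rw [h3]; rfl)
    refine ⟨φ y 5, (hD.mem_ballBoundary hK).2 ?_, ?_⟩
    · rw [hD.word_apply, hflip]
      rw [htv] at hy
      simpa using hy
    · have := hD.apply_flip y 5
      rwa [hflip] at this

theorem ncard_ballBoundary_one : (K.ballBoundary o 1).ncard = 8 := by
  have h : K.ballBoundary o 1 = Set.range (φ o) := by
    ext x
    constructor
    · intro hx
      exact (hD.isChart o).surj x (SimpleGraph.dist_eq_one_iff_adj.1 hx)
    · rintro ⟨i, rfl⟩
      exact SimpleGraph.dist_eq_one_iff_adj.2 (hD.adj_apply o i)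
  rw [h, ← Set.image_univ, Set.ncard_image_of_injective _ (hD.isChart o).injective,
    Set.ncard_univ, Nat.card_fin]

theorem ball_zero (hK : K.edgeGraph.Connected) : K.ball o 0 = {o} := by
  ext x
  rw [hD.mem_ball hK, Nat.le_zero, List.length_eq_zero_iff, Set.mem_singleton_iff]
  exact ⟨hD.eq_of_word_eq_nil hK, fun h => h ▸ hD.root⟩

theorem blackIn_ball_zero (hK : K.edgeGraph.Connected) (c : K.BWColoring) :
    c.blackIn (K.ball o 0) = ∅ := by
  rw [Set.eq_empty_iff_forall_notMem, hD.ball_zero hK]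
  rintro T ⟨hT, hTo⟩
  have h3 := (c.black_subset hT).2
  have h1 := Finset.card_le_card (Finset.coe_subset.1 (hTo.trans (Finset.coe_singleton o).ge))
  rw [Finset.card_singleton] at h1
  omega

/-- The number of vertices of a ball minus the number of its black triangles, doubled. -/
theorem even_and_two_mul_ncard_ball (hK : K.edgeGraph.Connected) (c : K.BWColoring) (n : ℕ) :
    Even (K.ballBoundary o (n + 1)).ncard ∧ 2 * (K.ball o (n + 1)).ncard =
      2 * (c.blackIn (K.ball o (n + 1))).ncard + (K.ballBoundary o (n + 1)).ncard + 2 := by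
  have hs := hD.two_mul_ncard_black hK c n
  have hN := hD.ncard_ball_succ hK n
  have hE := hD.ncard_blackIn_succ hK c n
  rw [Nat.even_iff]
  cases n with
  -- Here there are 9 vertices, 8 of them on the boundary, and 4 black triangles: layer one has no
  -- vertex with two parents.
  | zero =>
    have h3 : {x ∈ K.ballBoundary o (0 + 1) | arity (w x) = 3} = ∅ := by
      rw [Set.eq_empty_iff_forall_notMem]
      rintro x ⟨hx, hx3⟩
      rw [hD.mem_ballBoundary hK] at hx
      obtain ⟨t, ht⟩ := List.length_eq_one_iff.1 hx
      rw [ht] at hx3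
      simp [arity] at hx3
    have h8 := hD.ncard_ballBoundary_one
    rw [h3, Set.ncard_empty] at hs
    rw [hD.ball_zero hK, Set.ncard_singleton] at hN
    rw [hD.blackIn_ball_zero hK, Set.ncard_empty] at hE
    omega
  | succ n =>
    rw [show n + 1 + 1 = n + 2 from rfl] at hs hN hE ⊢
    rw [hD.ncard_arity_eq_three hK n] at hs
    -- The new layer adds `|∂D_{n+2}|` vertices and `(|∂D_{n+2}| + |∂D_{n+1}|) / 2` black triangles;
    -- integrality of the latter also propagates evenness.
    obtain ⟨he, ih⟩ := even_and_two_mul_ncard_ball hK c n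
    rw [Nat.even_iff] at he
    omega

end IsDeveloping

end AbstractSimplicialComplex

-- Linear algebra: coordinates chosen from a separating family.

universe u

/-- A separating family of linear functionals on a finite-dimensional space contains a subfamily of
functionals that are coordinates of the space. -/
theorem Module.Dual.exists_bijective_of_separating {𝕜 H : Type*} {ι : Type u} [Field 𝕜]
    [AddCommGroup H] [Module 𝕜 H] [FiniteDimensional 𝕜 H] (f : ι → Module.Dual 𝕜 H)
    (hf : ∀ ψ, (∀ i, f i ψ = 0) → ψ = 0) :
    ∃ (κ : Type u) (a : κ → ι), Function.Injective a ∧ Nat.card κ = Module.finrank 𝕜 H ∧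
      Function.Bijective fun (ψ : H) (k : κ) => f (a k) ψ := by
  obtain ⟨κ, a, ha, hspan, hli⟩ := exists_linearIndependent' 𝕜 f
  have hfin : Finite κ := hli.finite
  have := Fintype.ofFinite κ
  let F : H →ₗ[𝕜] κ → 𝕜 := LinearMap.pi fun k => f (a k)
  have hinj : Function.Injective F := by
    rw [← LinearMap.ker_eq_bot, LinearMap.ker_eq_bot']
    intro ψ hψ
    refine hf ψ fun i => ?_
    have hi : f i ∈ Submodule.span 𝕜 (Set.range (f ∘ a)) :=
      hspan ▸ Submodule.subset_span ⟨i, rfl⟩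
    -- A vector killed by the chosen independent functionals is killed by their span, which contains
    -- the whole family.
    have hle : Submodule.span 𝕜 (Set.range (f ∘ a)) ≤ LinearMap.ker (Module.Dual.eval 𝕜 H ψ) := by
      rw [Submodule.span_le]
      rintro _ ⟨k, rfl⟩
      exact congrFun hψ k
    exact hle hi
  have hcard : Fintype.card κ = Module.finrank 𝕜 H := by
    apply le_antisymm
    · have := hli.fintype_card_le_finrank
      rwa [Subspace.dual_finrank_eq] at this
    · have := LinearMap.finrank_le_finrank_of_injective hinj
      rwa [Module.finrank_fintype_fun_eq_card] at this
  refine ⟨κ, a, ha, by rw [Nat.card_eq_fintype_card, hcard], hinj, ?_⟩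
  exact (LinearMap.injective_iff_surjective_of_finrank_eq_finrank
    (by rw [Module.finrank_fintype_fun_eq_card, hcard])).1 hinj

namespace AbstractSimplicialComplex

variable {V : Type*} [DecidableEq V] {K : AbstractSimplicialComplex V}

/-! ### The black triangle operator of a ball -/

namespace BWColoring

variable (c : K.BWColoring) (𝕜 : Type*) [Field 𝕜] {D S : Set V}

theorem blackOperator_restrict (F : V → 𝕜) (T : c.blackIn D) :
    c.blackOperator 𝕜 D (fun x => F x) T = ∑ P ∈ T.1, F P :=
  Finset.sum_coe_sort T.1 F

/-- The values of a d-holomorphic function at the vertices of `S`, as a linear map. -/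
def boundaryValuesLinear (hS : S ⊆ D) : c.dHolomorphic 𝕜 D →ₗ[𝕜] S → 𝕜 where
  toFun := c.boundaryValues 𝕜 hS
  map_add' _ _ := rfl
  map_smul' _ _ := rfl

variable {𝕜}

theorem sum_eq_zero_of_mem_dHolomorphic {F : V → 𝕜} (hF : (fun x : D => F x) ∈ c.dHolomorphic 𝕜 D)
    {T : Finset V} (hT : T ∈ c.blackIn D) : ∑ P ∈ T, F P = 0 := by
  rw [← c.blackOperator_restrict 𝕜 F ⟨T, hT⟩, LinearMap.mem_ker.1 hF]
  rfl

end BWColoring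

namespace IsDeveloping

open BWColoring

variable {o : V} {w : V → List ℕ} {φ : V → Fin 8 → V} (hD : IsDeveloping K o w φ)
include hD

/-- The inhomogeneous equations in a ball can be solved. -/
theorem exists_sum_eq (hK : K.edgeGraph.Connected) (c : K.BWColoring) {𝕜 : Type*} [Field 𝕜]
    (g : Finset V → 𝕜) (n : ℕ) :
    ∃ F : V → 𝕜, ∀ T ∈ c.blackIn (K.ball o n), ∑ P ∈ T, F P = g T := by
  classical
  induction n with
  | zero => exact ⟨0, fun T hT => by simp [hD.blackIn_ball_zero hK] at hT⟩
  | succ n ih =>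
    obtain ⟨F, hF⟩ := ih
    have hpiv : ∀ T : {T // T ∈ c.blackIn (K.ball o (n + 1)) ∧ ∃ x ∈ T, (w x).length = n + 1},
        ∃ p ∈ T.1, (w p).length = n + 1 ∧
          ∀ T' ∈ c.blackIn (K.ball o (n + 1)), p ∈ T' → T' = T.1 := by
      rintro ⟨T, hT, x, hxT, hx⟩
      exact hD.exists_pivot hK c hT hxT hx
    choose p hpT hp hpu using hpiv
    -- Only pivot values are changed. A pivot determines its triangle, so the choice is unambiguous
    -- and each correction affects a single equation.
    let G : V → 𝕜 := fun x => if h : ∃ T, p T = x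
      then g h.choose.1 - ∑ P ∈ h.choose.1.erase x, F P else F x
    have hGp : ∀ T, G (p T) = g T.1 - ∑ P ∈ T.1.erase (p T), F P := by
      intro T
      have h : ∃ T', p T' = p T := ⟨T, rfl⟩
      have hT : h.choose = T :=
        Subtype.ext (hpu T h.choose.1 h.choose.2.1 (by
          have hc := hpT h.choose
          rwa [h.choose_spec] at hc))
      simp only [G]
      rw [dif_pos h, hT]
    refine ⟨G, fun T hT => ?_⟩
    by_cases hx : ∃ x ∈ T, (w x).length = n + 1
    · let T₁ : {T // T ∈ c.blackIn (K.ball o (n + 1)) ∧ ∃ x ∈ T, (w x).length = n + 1} :=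
        ⟨T, hT, hx⟩
      have hsum : ∑ P ∈ T.erase (p T₁), G P = ∑ P ∈ T.erase (p T₁), F P := by
        refine Finset.sum_congr rfl fun P hP => dif_neg ?_
        rintro ⟨T₂, rfl⟩
        rw [Finset.mem_erase] at hP
        have h : T₁ = T₂ := Subtype.ext (hpu T₂ T hT hP.2)
        exact hP.1 (h ▸ rfl)
      rw [← Finset.add_sum_erase T G (hpT T₁), hsum, hGp, sub_add_cancel]
    · push Not at hx
      have hT' : T ∈ c.blackIn (K.ball o n) := by
        refine ⟨hT.1, fun x hxT => (hD.mem_ball hK).2 ?_⟩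
        have := (hD.mem_ball hK).1 (hT.2 hxT)
        have := hx x hxT
        omega
      rw [← hF T hT']
      refine Finset.sum_congr rfl fun P hP => dif_neg ?_
      rintro ⟨T₂, rfl⟩
      exact hx _ hP (hp T₂)

theorem blackOperator_surjective (hK : K.edgeGraph.Connected) (c : K.BWColoring) (𝕜 : Type*)
    [Field 𝕜] (n : ℕ) : Function.Surjective (c.blackOperator 𝕜 (K.ball o n)) := by
  classical
  intro g
  obtain ⟨F, hF⟩ := hD.exists_sum_eq hK c
    (fun T => if h : T ∈ c.blackIn (K.ball o n) then g ⟨T, h⟩ else 0) n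
  refine ⟨fun x => F x, funext fun T => ?_⟩
  rw [c.blackOperator_restrict, hF T T.2, dif_pos T.2]

/-- The dimension of the space of d-holomorphic functions in a ball. -/
theorem finrank_dHolomorphic (hK : K.edgeGraph.Connected) (c : K.BWColoring) (𝕜 : Type*)
    [Field 𝕜] (n : ℕ) :
    (c.blackIn (K.ball o n)).ncard + Module.finrank 𝕜 (c.dHolomorphic 𝕜 (K.ball o n)) =
      (K.ball o n).ncard := by
  have := (hD.finite_ball hK n).fintype
  have := (c.finite_blackIn (hD.finite_ball hK n)).fintype
  have h := LinearMap.finrank_range_add_finrank_ker (c.blackOperator 𝕜 (K.ball o n))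
  rw [LinearMap.range_eq_top.2 (hD.blackOperator_surjective hK c 𝕜 n), finrank_top,
    Module.finrank_fintype_fun_eq_card, Module.finrank_fintype_fun_eq_card,
    ← Nat.card_eq_fintype_card, ← Nat.card_eq_fintype_card] at h
  exact h

/-- A d-holomorphic function in a ball that vanishes on the boundary vanishes. -/
theorem eq_zero_of_boundary (hK : K.edgeGraph.Connected) (c : K.BWColoring) {𝕜 : Type*} [Field 𝕜]
    (n : ℕ) {F : V → 𝕜} (hF : (fun x : K.ball o n => F x) ∈ c.dHolomorphic 𝕜 (K.ball o n))
    (h0 : ∀ x ∈ K.ballBoundary o n, F x = 0) (x : V) (hx : x ∈ K.ball o n) : F x = 0 := by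
  rw [hD.mem_ball hK] at hx
  -- Induction on the depth `k` below the boundary: a black triangle pointing outwards expresses `F
  -- x` through two values at depth `k - 1`.
  obtain ⟨k, hk⟩ := Nat.exists_eq_add_of_le hx
  induction k generalizing x with
  | zero => exact h0 x ((hD.mem_ballBoundary hK).2 (by omega))
  | succ k ih =>
    obtain ⟨y, z, hb, hy, hz⟩ := hD.exists_black_up c x
    have h3 := (c.black_subset hb).2
    have hsum := c.sum_eq_zero_of_mem_dHolomorphic hF (T := {x, y, z}) ⟨hb, by
      simp only [Finset.coe_insert, Finset.coe_singleton, Set.insert_subset_iff,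
        Set.singleton_subset_iff, hD.mem_ball hK]
      omega⟩
    rw [Finset.sum_eq_single_of_mem x (by simp)] at hsum
    · exact hsum
    · intro P hP hPx
      rw [Finset.mem_insert, Finset.mem_insert, Finset.mem_singleton] at hP
      rcases hP with rfl | rfl | rfl
      · exact absurd rfl hPx
      · exact ih _ (by omega) (by omega)
      · exact ih _ (by omega) (by omega)

end IsDeveloping

end AbstractSimplicialComplex

/-! ### Assembly of the counts and the boundary data. -/

theorem mainTheorem2 {V : Type*} [DecidableEq V] (K : AbstractSimplicialComplex V)
    (hK : K.IsEquilateralLattice 8) (c : K.BWColoring) (o : V)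
    (𝕜 : Type*) [RCLike 𝕜] (r : ℕ) :
    -- finiteness of the objects that are counted
    (K.ball o (r + 1)).Finite ∧ (c.blackIn (K.ball o (r + 1))).Finite ∧
    -- number of vertices minus number of equations
    Even (K.ballBoundary o (r + 1)).ncard ∧
    ((K.ball o (r + 1)).ncard : ℤ) - ((c.blackIn (K.ball o (r + 1))).ncard : ℤ)
      = ((K.ballBoundary o (r + 1)).ncard / 2 + 1 : ℕ) ∧
    -- dimension of the space of d-holomorphic functions in the ball
    Module.finrank 𝕜 (c.dHolomorphic 𝕜 (K.ball o (r + 1)))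
      = (K.ballBoundary o (r + 1)).ncard / 2 + 1 ∧
    -- suitable boundary data of this number determine the function (and can be prescribed freely)
    (∃ (S : Set V) (hS : S ⊆ K.ballBoundary o (r + 1)),
      S.ncard = (K.ballBoundary o (r + 1)).ncard / 2 + 1 ∧
      Function.Bijective
        (c.boundaryValues 𝕜 (hS.trans (K.ballBoundary_subset_ball o (r + 1))))) ∧
    -- fewer data never determine the function
    (∀ (S : Set V) (hS : S ⊆ K.ballBoundary o (r + 1)),
      Function.Injective
        (c.boundaryValues 𝕜 (hS.trans (K.ballBoundary_subset_ball o (r + 1)))) →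
      (K.ballBoundary o (r + 1)).ncard / 2 + 1 ≤ S.ncard) := by
  classical
  have hconn := hK.connected
  obtain ⟨w, φ, hD⟩ := hK.exists_isDeveloping o
  have hfin := hD.finite_ball hconn (r + 1)
  obtain ⟨heven, hcount⟩ := hD.even_and_two_mul_ncard_ball hconn c r
  have hdim := hD.finrank_dHolomorphic hconn c 𝕜 (r + 1)
  have heven' := Nat.even_iff.1 heven
  have hrank : Module.finrank 𝕜 (c.dHolomorphic 𝕜 (K.ball o (r + 1)))
      = (K.ballBoundary o (r + 1)).ncard / 2 + 1 := by omega
  have := hfin.fintype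
  refine ⟨hfin, c.finite_blackIn hfin, heven, by omega, hrank, ?_, ?_⟩
  -- The functionals are the evaluations at boundary vertices; `eq_zero_of_boundary` says that they
  -- separate.
  · let f : K.ballBoundary o (r + 1) → Module.Dual 𝕜 (c.dHolomorphic 𝕜 (K.ball o (r + 1))) :=
      fun x => (LinearMap.proj (⟨x, K.ballBoundary_subset_ball o _ x.2⟩ : K.ball o (r + 1))) ∘ₗ
        (c.dHolomorphic 𝕜 (K.ball o (r + 1))).subtype
    obtain ⟨κ, a, ha, hcard, hinj, hsurj⟩ := Module.Dual.exists_bijective_of_separating f (by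
      rintro ⟨ψ, hψ⟩ h
      let F : V → 𝕜 := fun x => if hx : x ∈ K.ball o (r + 1) then ψ ⟨x, hx⟩ else 0
      have hFψ : (fun x : K.ball o (r + 1) => F x) = ψ := funext fun x => dif_pos x.2
      ext x
      change ψ x = 0
      rw [← congrFun hFψ x]
      refine hD.eq_zero_of_boundary hconn c (r + 1) (hFψ ▸ hψ) (fun y hy => ?_) x x.2
      exact (congrFun hFψ ⟨y, K.ballBoundary_subset_ball o _ hy⟩).trans (h ⟨y, hy⟩))
    have ha' : Function.Injective fun k => (a k).1 := Subtype.val_injective.comp ha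
    refine ⟨Set.range fun k => (a k).1, ?_, ?_, ?_, ?_⟩
    · rintro _ ⟨k, rfl⟩
      exact (a k).2
    · rw [← Set.image_univ, Set.ncard_image_of_injective _ ha', Set.ncard_univ, hcard, hrank]
    · intro ψ χ h
      exact hinj (funext fun k => congrFun h ⟨_, k, rfl⟩)
    · intro t
      obtain ⟨ψ, hψ⟩ := hsurj fun k => t ⟨_, k, rfl⟩
      refine ⟨ψ, funext ?_⟩
      rintro ⟨_, k, rfl⟩
      exact congrFun hψ k
  · intro S hS hinj
    have := (hfin.subset (hS.trans (K.ballBoundary_subset_ball o _))).fintype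
    have h := LinearMap.finrank_le_finrank_of_injective
      (f := c.boundaryValuesLinear 𝕜 (hS.trans (K.ballBoundary_subset_ball o (r + 1)))) hinj
    rwa [hrank, Module.finrank_fintype_fun_eq_card, ← Nat.card_eq_fintype_card] at h
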